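/- **Theorem.** Let $p$ be a prime, $\mathbb Z[1/p]=\{q/p^k: q\in\mathbb Z,\ k\in\mathbb N\}\subset\mathbb Q$, and let $\Gamma=\mathbb Z[1/p]\times\mathbb Z[1/p]$ as a discrete group. Let $\Omega_p$ be the set of sequences $\theta=(\theta_n)_{n\ge 0}$ in $[0,1)$ with $p\theta_n\equiv\theta_{n-1} \pmod{\mathbb Z}$ for all $n\ge 1$. For $\theta\in\Omega_p$ let $\sigma_\theta$ be the ($\mathbb T$-valued) multiplier on $\Gamma$ $$\sigma_\theta\Big(\big(\tfrac{q_1}{p^{k_1}},\tfrac{q_2}{p^{k_2}}\big),\big(\tfrac{q_3}{p^{k_3}},\tfrac{q_4}{p^{k_4}}\big)\Big)=\exp\big(2\pi i\,\theta_{k_1+k_4}\,q_1q_4\big).$$ Let $\ell^1(\Gamma,\sigma_\theta)$ be the Banach $*$-algebra $\ell^1(\Gamma)$ with $$(f_1*f_2)(\gamma)=\sum_{\gamma_1\in\Gamma} \sigma_\theta(\gamma_1,\gamma-\gamma_1) f_1(\gamma_1)f_2(\gamma-\gamma_1),\qquad f^*(\gamma)=\overline{f(-\gamma)\,\sigma_\theta(\gamma,-\gamma)},$$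 and let the noncommutative solenoid $\mathcal A_\theta^{\mathcal S}=C^*(\Gamma,\sigma_\theta)$ be its enveloping $C^*$-algebra, i.e. its completion in the norm $\sup_\pi\|\pi(f)\|$, where $\pi$ ranges over the $*$-representations of $\ell^1(\Gamma,\sigma_\theta)$ on Hilbert spaces. Let $C_C(\Gamma,\sigma_\theta)$ be the $*$-subalgebra of finitely supported functions, and let $\lambda_{\sigma_\theta}$ be the left $\sigma_\theta$-regular representation of $C^*(\Gamma,\sigma_\theta)$ on $\ell^2(\Gamma)$, which is given on $\ell^1(\Gamma,\sigma_\theta)$ by $$(\lambda_{\sigma_\theta}(f)g)(\gamma)=\sum_{\gamma_1\in\Gamma}\sigma_\theta(\gamma_1,\gamma-\gamma_1)f(\gamma_1)g(\gamma-\gamma_1).$$ Let $\mathcal D_p$ be the operator on $\ell^2(\Gamma)$ of pointwise multiplication by $$\mathbb L_p^\Sigma(r,s)=|r|+\|r\|_p+|s|+\|s\|_p,$$ where $\|\cdot\|_p$ is the $p$-adic norm, with its maximal domain $\{g\in\ell^2(\Gamma):\mathbb L_p^\Sigma g\in\ell^2(\Gamma)\}$. Then, for every $\theta\in\Omega_p$,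 $(\mathcal A_\theta^{\mathcal S},\ell^2(\Gamma),\mathcal D_p)$ with the representation $\lambda_{\sigma_\theta}$ is an (odd, i.e. ungraded) spectral triple with smooth subalgebra $C_C(\Gamma,\sigma_\theta)$. That is: $\lambda_{\sigma_\theta}$ is a unital faithful representation; $\mathcal D_p$ is self-adjoint; $(\mathcal D_p-z)^{-1}$ is compact for every $z$ in the (non-empty) resolvent set of $\mathcal D_p$; $C_C(\Gamma,\sigma_\theta)$ is dense in $\mathcal A_\theta^{\mathcal S}$; and for every $a\in C_C(\Gamma,\sigma_\theta)$ the commutator $[\mathcal D_p,\lambda_{\sigma_\theta}(a)]$ is densely defined and extends to a bounded operator on $\ell^2(\Gamma)$. Furthermore, this spectral triple is finitely summable: there is $s>0$ such that $(1+\mathcal D_p^2)^{-t/2}$ is of trace class for every $t>s$. -/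

import Mathlib

set_option linter.unusedSectionVars false

open scoped ENNReal InnerProductSpace

noncomputable section

/-! ### Multipliers and the twisted group algebra -/

/-- A (normalized) multiplier on a discrete abelian group `G`, written additively:
a `2`-cocycle on `G` with values in the circle. -/
structure Multiplier (G : Type) [AddCommGroup G] where
  toFun : G → G → Circle
  cocycle : ∀ a b c, toFun a b * toFun (a + b) c = toFun a (b + c) * toFun b c
  map_zero_left : ∀ a, toFun 0 a = 1
  map_zero_right : ∀ a, toFun a 0 = 1

namespace Multiplier

section

variable {G : Type}

lemma summable_norm_l1 (f : lp (fun _ : G => ℂ) 1) : Summable fun a => ‖f a‖ := by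
  simpa using (lp.memℓp f).summable (by simp)

lemma tsum_norm_l1 (f : lp (fun _ : G => ℂ) 1) : ∑' a, ‖f a‖ = ‖f‖ := by
  simpa using (lp.norm_eq_tsum_rpow (p := 1) (by simp) f).symm

open scoped Classical in
lemma induction_l1 {P : lp (fun _ : G => ℂ) 1 → Prop} (hc : IsClosed {f | P f})
    (h0 : P 0) (hadd : ∀ f g, P f → P g → P (f + g)) (hs : ∀ a x, P (lp.single 1 a x))
    (f : lp (fun _ : G => ℂ) 1) : P f := by
  refine hc.mem_of_tendsto (lp.hasSum_single (by simp) f) (Filter.Eventually.of_forall fun s => ?_)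
  induction s using Finset.cons_induction with
  | empty => simpa using h0
  | cons a s ha ih =>
    rw [Finset.sum_cons]
    exact hadd _ _ (hs _ _) ih

end

variable {G : Type} [AddCommGroup G] (σ : Multiplier G)

instance : CoeFun (Multiplier G) (fun _ => G → G → Circle) := ⟨Multiplier.toFun⟩

variable (p : ℝ≥0∞) [Fact (1 ≤ p)]

lemma memlp_translate (a : G) (g : lp (fun _ : G => ℂ) p) :
    Memℓp (fun c : G => (σ a (c - a) : ℂ) * g (c - a)) p := by
  have hg := lp.memℓp g
  rcases p.trichotomy with rfl | rfl | hp
  · exact absurd (Fact.out : (1 : ℝ≥0∞) ≤ 0) (by simp)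
  · rw [memℓp_infty_iff] at hg ⊢
    refine hg.mono ?_
    rintro _ ⟨c, rfl⟩
    exact ⟨c - a, by simp [Circle.norm_coe]⟩
  · rw [memℓp_gen_iff hp] at hg ⊢
    simpa [Function.comp_def, Circle.norm_coe] using (Equiv.subRight a).summable_iff.2 hg

/-- The twisted translation `g ↦ (c ↦ σ(a, c - a) g(c - a))` on `ℓᵖ(G)`. -/
def translate (a : G) : lp (fun _ : G => ℂ) p →ₗᵢ[ℂ] lp (fun _ : G => ℂ) p where
  toFun g := ⟨fun c => (σ a (c - a) : ℂ) * g (c - a), σ.memlp_translate p a g⟩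
  map_add' f g := by
    ext c
    exact mul_add _ _ _
  map_smul' z f := by
    ext c
    simp [mul_left_comm]
  norm_map' g := by
    rcases p.trichotomy with rfl | rfl | hp
    · exact absurd (Fact.out : (1 : ℝ≥0∞) ≤ 0) (by simp)
    · rw [lp.norm_eq_ciSup, lp.norm_eq_ciSup]
      simpa [Circle.norm_coe] using (Equiv.subRight a).iSup_comp (g := fun c => ‖g c‖)
    · rw [lp.norm_eq_tsum_rpow hp, lp.norm_eq_tsum_rpow hp]
      congr 1
      simpa [Function.comp_def, Circle.norm_coe] using (Equiv.subRight a).tsum_eq (fun c => ‖g c‖ ^ p.toReal)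

@[simp] lemma translate_apply (a : G) (g : lp (fun _ : G => ℂ) p) (c : G) :
    σ.translate p a g c = (σ a (c - a) : ℂ) * g (c - a) := rfl

lemma translate_translate (a b : G) (g : lp (fun _ : G => ℂ) p) :
    σ.translate p a (σ.translate p b g) = (σ a b : ℂ) • σ.translate p (a + b) g := by
  ext c
  have h := congrArg (fun z : Circle => (z : ℂ)) (σ.cocycle a b (c - (a + b)))
  simp only [Circle.coe_mul] at h
  have e : b + (c - (a + b)) = c - a := by abel
  have e2 : c - a - b = c - (a + b) := by abel
  rw [e] at h
  simp only [translate_apply, lp.coeFn_smul, Pi.smul_apply, smul_eq_mul, e2]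
  rw [← mul_assoc, ← mul_assoc, h]

/-- The twisted translation as a bounded operator. -/
def translateL (a : G) : lp (fun _ : G => ℂ) p →L[ℂ] lp (fun _ : G => ℂ) p :=
  (σ.translate p a).toContinuousLinearMap

lemma norm_translateL_le (a : G) : ‖σ.translateL p a‖ ≤ 1 :=
  (σ.translate p a).norm_toContinuousLinearMap_le

lemma norm_smul_translateL_le (f : lp (fun _ : G => ℂ) 1) (a : G) :
    ‖f a • σ.translateL p a‖ ≤ ‖f a‖ := by
  rw [norm_smul]
  exact mul_le_of_le_one_right (norm_nonneg _) (σ.norm_translateL_le p a)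

lemma summable_smul_translateL (f : lp (fun _ : G => ℂ) 1) :
    Summable fun a => f a • σ.translateL p a :=
  Summable.of_norm_bounded (summable_norm_l1 f) (σ.norm_smul_translateL_le p f)

/-- Twisted convolution by `f ∈ ℓ¹(G)` on `ℓᵖ(G)`: the norm-convergent sum
`∑ a, f(a) • (translation by a)`. -/
def conv : lp (fun _ : G => ℂ) 1 →L[ℂ] (lp (fun _ : G => ℂ) p →L[ℂ] lp (fun _ : G => ℂ) p) :=
  LinearMap.mkContinuous
    { toFun := fun f => ∑' a, f a • σ.translateL p a
      map_add' := fun f g => by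
        rw [← (σ.summable_smul_translateL p f).tsum_add (σ.summable_smul_translateL p g)]
        simp [add_smul]
      map_smul' := fun z f => by
        simp only [RingHom.id_apply]
        rw [← (σ.summable_smul_translateL p f).tsum_const_smul z]
        simp [mul_smul] } 1 (fun f => by
      simp only [LinearMap.coe_mk, AddHom.coe_mk, one_mul]
      rw [← tsum_norm_l1 f]
      exact tsum_of_norm_bounded (summable_norm_l1 f).hasSum (σ.norm_smul_translateL_le p f))

lemma conv_eq (f : lp (fun _ : G => ℂ) 1) : σ.conv p f = ∑' a, f a • σ.translateL p a := rfl

lemma norm_conv_apply_le (f : lp (fun _ : G => ℂ) 1) (g : lp (fun _ : G => ℂ) p) :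
    ‖σ.conv p f g‖ ≤ ‖f‖ * ‖g‖ := by
  refine (ContinuousLinearMap.le_opNorm _ _).trans ?_
  gcongr
  have := LinearMap.mkContinuous_norm_le (C := 1) _ zero_le_one (fun f => by
      simp only [LinearMap.coe_mk, AddHom.coe_mk, one_mul]
      rw [← tsum_norm_l1 f]
      exact tsum_of_norm_bounded (summable_norm_l1 f).hasSum (σ.norm_smul_translateL_le p f))
    |> (ContinuousLinearMap.le_opNorm (σ.conv p) f |>.trans <| mul_le_mul_of_nonneg_right · (norm_nonneg f))
  simpa using this

/-- The pointwise formula for twisted convolution. -/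
lemma conv_apply (f : lp (fun _ : G => ℂ) 1) (g : lp (fun _ : G => ℂ) p) (c : G) :
    σ.conv p f g c = ∑' a, (σ a (c - a) : ℂ) * f a * g (c - a) := by
  have h := (σ.summable_smul_translateL p f).hasSum
  have h1 := (h.mapL ((lp.evalCLM ℂ (fun _ : G => ℂ) p c).comp
    (ContinuousLinearMap.apply ℂ (lp (fun _ : G => ℂ) p) g))).tsum_eq
  rw [conv_eq]
  refine h1.symm.trans (tsum_congr fun a => ?_)
  change f a * ((σ a (c - a) : ℂ) * g (c - a)) = _
  ring

open scoped Classical in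
lemma conv_single (a : G) (x : ℂ) : σ.conv p (lp.single 1 a x) = x • σ.translateL p a := by
  rw [conv_eq, tsum_eq_single a]
  · simp
  · intro b hb
    simp [Pi.single_eq_of_ne hb]

open scoped Classical in
lemma translate_single (a b : G) (y : ℂ) :
    σ.translateL p a (lp.single p b y) = lp.single p (a + b) ((σ a b : ℂ) * y) := by
  ext c
  change (σ a (c - a) : ℂ) * (lp.single p b y : lp (fun _ : G => ℂ) p) (c - a) = _
  by_cases h : c = a + b
  · subst h
    simp
  · rw [lp.single_apply_ne _ _ _ h, lp.single_apply_ne, mul_zero]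
    intro h'
    exact h (by rw [← h']; abel)

open scoped Classical in
/-- Twisted convolution is associative. -/
lemma conv_conv (f g : lp (fun _ : G => ℂ) 1) :
    σ.conv p (σ.conv 1 f g) = (σ.conv p f).comp (σ.conv p g) := by
  refine induction_l1 (P := fun f => σ.conv p (σ.conv 1 f g) = (σ.conv p f).comp (σ.conv p g))
    (isClosed_eq ?_ ?_) ?_ ?_ ?_ f
  · exact (σ.conv p).continuous.comp
      ((ContinuousLinearMap.apply ℂ _ g).continuous.comp (σ.conv 1).continuous)
  · exact (σ.conv p).continuous.clm_comp continuous_const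
  · simp
  · intro f f' h h'
    simp [h, h', ContinuousLinearMap.add_comp]
  · intro a x
    refine induction_l1 (P := fun g => σ.conv p (σ.conv 1 (lp.single 1 a x) g) =
      (σ.conv p (lp.single 1 a x)).comp (σ.conv p g)) (isClosed_eq ?_ ?_) ?_ ?_ ?_ g
    · exact (σ.conv p).continuous.comp (σ.conv 1 _).continuous
    · exact continuous_const.clm_comp (σ.conv p).continuous
    · simp
    · intro f f' h h'
      simp only [map_add, h, h', ContinuousLinearMap.comp_add]
    · intro b y
      rw [conv_single, smul_apply, translate_single, conv_single, ← lp.single_smul,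
        conv_single, conv_single]
      ext1 h
      change (x * ((σ a b : ℂ) * y)) • σ.translate p (a + b) h =
        x • σ.translate p a (y • σ.translate p b h)
      rw [LinearIsometry.map_smul, translate_translate, smul_smul, smul_smul]
      congr 1
      ring

end Multiplier

/-- The twisted group algebra `ℓ¹(G, σ)`. -/
def TwistedL1 {G : Type} [AddCommGroup G] (_σ : Multiplier G) : Type :=
  lp (fun _ : G => ℂ) 1

namespace TwistedL1

variable {G : Type} [AddCommGroup G] {σ : Multiplier G}

instance : NormedAddCommGroup (TwistedL1 σ) :=
  inferInstanceAs (NormedAddCommGroup (lp (fun _ : G => ℂ) 1))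

instance : NormedSpace ℂ (TwistedL1 σ) :=
  inferInstanceAs (NormedSpace ℂ (lp (fun _ : G => ℂ) 1))

instance : CompleteSpace (TwistedL1 σ) :=
  inferInstanceAs (CompleteSpace (lp (fun _ : G => ℂ) 1))

instance : CoeFun (TwistedL1 σ) (fun _ => G → ℂ) := ⟨fun f => f.1⟩

@[ext] lemma ext {f g : TwistedL1 σ} (h : ∀ c, f c = g c) : f = g :=
  lp.ext (funext h)

open scoped Classical in
/-- The element `x • δ_a` of `ℓ¹(G, σ)`. -/
def single (a : G) (x : ℂ) : TwistedL1 σ := (lp.single 1 a x : lp (fun _ : G => ℂ) 1)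

lemma induction {P : TwistedL1 σ → Prop} (hc : IsClosed {f | P f})
    (h0 : P 0) (hadd : ∀ f g, P f → P g → P (f + g)) (hs : ∀ a x, P (single a x))
    (f : TwistedL1 σ) : P f :=
  Multiplier.induction_l1 (P := P) hc h0 hadd (fun a x => hs a x) f

@[simp] lemma add_apply (f g : TwistedL1 σ) (c : G) : (f + g) c = f c + g c := rfl
@[simp] lemma zero_apply (c : G) : (0 : TwistedL1 σ) c = 0 := rfl
@[simp] lemma smul_apply (z : ℂ) (f : TwistedL1 σ) (c : G) : (z • f) c = z * f c := rfl

lemma single_apply_self (a : G) (x : ℂ) : (single a x : TwistedL1 σ) a = x := by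
  classical
  exact Pi.single_eq_same (M := fun _ => ℂ) a x

lemma single_apply_ne {a b : G} (h : b ≠ a) (x : ℂ) : (single a x : TwistedL1 σ) b = 0 := by
  classical
  exact Pi.single_eq_of_ne (M := fun _ => ℂ) h x

instance : One (TwistedL1 σ) := ⟨single 0 1⟩

/-- Twisted convolution as a bounded bilinear map of `ℓ¹(G, σ)`. -/
def mulL (σ : Multiplier G) : TwistedL1 σ →L[ℂ] (TwistedL1 σ →L[ℂ] TwistedL1 σ) := σ.conv 1

/-- The action of `ℓ¹(G, σ)` on `ℓ²(G)` by twisted convolution. -/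
def convL2 (σ : Multiplier G) :
    TwistedL1 σ →L[ℂ] (lp (fun _ : G => ℂ) 2 →L[ℂ] lp (fun _ : G => ℂ) 2) := σ.conv 2

instance : Mul (TwistedL1 σ) := ⟨fun f g => mulL σ f g⟩

lemma mul_def (f g : TwistedL1 σ) : f * g = mulL σ f g := rfl

/-- The product of `ℓ¹(G, σ)` is the twisted convolution. -/
lemma mul_apply (f g : TwistedL1 σ) (c : G) :
    (f * g) c = ∑' a, (σ a (c - a) : ℂ) * f a * g (c - a) :=
  σ.conv_apply 1 f g c

lemma single_mul_single (a b : G) (x y : ℂ) :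
    (single a x * single b y : TwistedL1 σ) = single (a + b) (σ a b * (x * y)) := by
  classical
  change σ.conv 1 (lp.single 1 a x) (lp.single 1 b y) = lp.single 1 (a + b) (σ a b * (x * y))
  rw [Multiplier.conv_single]
  change x • σ.translateL 1 a (lp.single 1 b y) = _
  rw [Multiplier.translate_single, ← lp.single_smul]
  congr 1
  simp [mul_left_comm]

instance : NormedRing (TwistedL1 σ) where
  left_distrib f g h := by simp [mul_def]
  right_distrib f g h := by simp [mul_def]
  zero_mul f := by simp [mul_def]
  mul_zero f := by simp [mul_def]
  mul_assoc f g h := by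
    have : mulL σ (f * g) = (mulL σ f).comp (mulL σ g) := σ.conv_conv 1 f g
    exact congrArg (fun T : TwistedL1 σ →L[ℂ] TwistedL1 σ => T h) this
  one_mul f := by
    ext c
    rw [mul_apply, tsum_eq_single 0]
    · have h1 : (1 : TwistedL1 σ) 0 = 1 := single_apply_self 0 1
      rw [h1, sub_zero, σ.map_zero_left]
      simp
    · intro a ha
      simp [single_apply_ne ha, show (1 : TwistedL1 σ) = single 0 1 from rfl]
  mul_one f := by
    ext c
    rw [mul_apply, tsum_eq_single c]
    · have h1 : (1 : TwistedL1 σ) 0 = 1 := single_apply_self 0 1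
      rw [sub_self, h1, σ.map_zero_right]
      simp
    · intro a ha
      have : c - a ≠ 0 := fun h => ha (sub_eq_zero.1 h).symm
      simp [single_apply_ne this, show (1 : TwistedL1 σ) = single 0 1 from rfl]
  dist_eq f g := dist_eq_norm_neg_add f g
  norm_mul_le f g := σ.norm_conv_apply_le 1 f g

lemma one_def : (1 : TwistedL1 σ) = single 0 1 := rfl

instance : NormOneClass (TwistedL1 σ) where
  norm_one := by
    classical
    have := lp.norm_single (E := fun _ : G => ℂ) (p := 1) (by simp) 0 1
    rw [norm_one] at this
    exact this

instance : Algebra ℂ (TwistedL1 σ) :=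
  Algebra.ofModule
    (fun z f g => by simp [mul_def])
    (fun z f g => by simp [mul_def])

instance : NormedAlgebra ℂ (TwistedL1 σ) where
  norm_smul_le z f := norm_smul_le z f

end TwistedL1

lemma Multiplier.neg_comm {G : Type} [AddCommGroup G] (σ : Multiplier G) (a : G) :
    σ a (-a) = σ (-a) a := by
  have := σ.cocycle a (-a) a
  simpa [σ.map_zero_left, σ.map_zero_right] using this

namespace TwistedL1

variable {G : Type} [AddCommGroup G] {σ : Multiplier G}

lemma memlp_star (f : TwistedL1 σ) :
    Memℓp (fun c : G => starRingEnd ℂ (f (-c) * σ c (-c))) 1 := by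
  have hf := Multiplier.summable_norm_l1 f
  rw [memℓp_gen_iff (by simp)]
  simpa [Function.comp_def, Circle.norm_coe] using (Equiv.neg G).summable_iff.2 hf

/-- The adjoint of `ℓ¹(G, σ)`: `f*(c) = conj (f(-c) σ(c, -c))`. -/
instance : Star (TwistedL1 σ) :=
  ⟨fun f => (⟨fun c => starRingEnd ℂ (f (-c) * σ c (-c)), memlp_star f⟩ :
    lp (fun _ : G => ℂ) 1)⟩

lemma star_apply (f : TwistedL1 σ) (c : G) :
    (star f) c = starRingEnd ℂ (f (-c) * σ c (-c)) := rfl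

lemma star_single (a : G) (x : ℂ) :
    star (single a x : TwistedL1 σ) = single (-a) (starRingEnd ℂ (x * σ (-a) a)) := by
  ext c
  rw [star_apply]
  by_cases h : c = -a
  · subst h
    rw [single_apply_self, neg_neg, single_apply_self]
  · have h' : -c ≠ a := fun h' => h (by rw [← h', neg_neg])
    simp [single_apply_ne h, single_apply_ne h']

lemma star_add' (f g : TwistedL1 σ) : star (f + g) = star f + star g := by
  ext c
  simp [star_apply, add_mul]

lemma norm_star' (f : TwistedL1 σ) : ‖star f‖ = ‖f‖ := by
  have h : ∑' a, ‖f a‖ = ‖f‖ := Multiplier.tsum_norm_l1 f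
  let s : TwistedL1 σ := star f
  have h' : ∑' a, ‖s a‖ = ‖s‖ := Multiplier.tsum_norm_l1 s
  refine h'.symm.trans (Eq.trans ?_ h)
  have := (Equiv.neg G).tsum_eq (fun c => ‖f c‖)
  refine Eq.trans (tsum_congr fun c => ?_) this
  change ‖(star f) c‖ = _
  rw [star_apply, RCLike.norm_conj, norm_mul, Circle.norm_coe, mul_one]
  rfl

lemma continuous_star' : Continuous (star : TwistedL1 σ → TwistedL1 σ) :=
  (AddMonoidHomClass.isometry_of_norm (AddMonoidHom.mk' star star_add') norm_star').continuous

lemma star_zero' : star (0 : TwistedL1 σ) = 0 := by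
  ext c
  simp [star_apply]

lemma star_mul_aux (a b : G) :
    σ a b * σ (-(a + b)) (a + b) * σ (-b) (-a) = σ (-b) b * σ (-a) a := by
  have h1 := σ.cocycle (-b) (-a) a
  have h2 := σ.cocycle (-b + -a) a b
  rw [neg_add_cancel, σ.map_zero_right, one_mul] at h1
  rw [neg_add_cancel_right] at h2
  have e : -(a + b) = -b + -a := by abel
  rw [e, mul_comm (σ a b), ← h2, ← h1]
  simp only [mul_comm, mul_left_comm]

instance : StarRing (TwistedL1 σ) where
  star_involutive f := by
    ext c
    have h : (starRingEnd ℂ (σ c (-c) : ℂ)) * (σ c (-c) : ℂ) = 1 := by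
      rw [mul_comm, Complex.mul_conj, Circle.normSq_coe, Complex.ofReal_one]
    rw [star_apply, star_apply, neg_neg, map_mul, map_mul, map_mul, Complex.conj_conj,
      Complex.conj_conj, ← σ.neg_comm, mul_right_comm, mul_assoc, h, mul_one]
  star_add := star_add'
  star_mul f g := by
    refine induction (P := fun f => star (f * g) = star g * star f)
      (isClosed_eq ?_ ?_) ?_ ?_ ?_ f
    · exact continuous_star'.comp (continuous_id.mul continuous_const)
    · exact continuous_const.mul continuous_star'
    · simp [star_zero']
    · intro f f' h h'
      rw [add_mul, star_add', star_add', h, h', mul_add]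
    · intro a x
      refine induction (P := fun g => star (single a x * g) = star g * star (single a x))
        (isClosed_eq ?_ ?_) ?_ ?_ ?_ g
      · exact continuous_star'.comp (continuous_const.mul continuous_id)
      · exact continuous_star'.mul continuous_const
      · simp [star_zero']
      · intro f f' h h'
        rw [mul_add, star_add', star_add', h, h', add_mul]
      · intro b y
        have h := congrArg (fun z : Circle => (z : ℂ)) (star_mul_aux (σ := σ) a b)
        simp only [Circle.coe_mul] at h
        rw [single_mul_single, star_single, star_single, star_single, single_mul_single,
          ← neg_add_rev]
        congr 1
        have hu : (starRingEnd ℂ (σ (-b) (-a) : ℂ)) * (σ (-b) (-a) : ℂ) = 1 := by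
          rw [mul_comm, Complex.mul_conj, Circle.normSq_coe, Complex.ofReal_one]
        have h' := congrArg (starRingEnd ℂ) h
        simp only [map_mul] at h' ⊢
        linear_combination
          (starRingEnd ℂ x * starRingEnd ℂ y * (σ (-b) (-a) : ℂ)) * h' -
          (starRingEnd ℂ x * starRingEnd ℂ y * starRingEnd ℂ (σ a b : ℂ) *
            starRingEnd ℂ (σ (-(a + b)) (a + b) : ℂ)) * hu

instance : NormedStarGroup (TwistedL1 σ) where
  norm_star_le f := (norm_star' f).le

instance : StarModule ℂ (TwistedL1 σ) where
  star_smul z f := by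
    ext c
    simp [star_apply, mul_assoc]

lemma inner_translateL (a : G) (x y : lp (fun _ : G => ℂ) 2) :
    ⟪(starRingEnd ℂ (σ (-a) a : ℂ)) • σ.translateL 2 (-a) x, y⟫_ℂ = ⟪x, σ.translateL 2 a y⟫_ℂ := by
  have h : σ.translate 2 (-a) (σ.translate 2 a y) = (σ (-a) a : ℂ) • y := by
    rw [Multiplier.translate_translate]
    congr 1
    ext c
    rw [Multiplier.translate_apply, neg_add_cancel, sub_zero, σ.map_zero_left]
    simp
  have h2 := (σ.translate 2 (-a)).inner_map_map x (σ.translate 2 a y)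
  rw [h, inner_smul_right] at h2
  rw [inner_smul_left, Complex.conj_conj]
  exact h2

lemma convL2_single (a : G) (x : ℂ) : convL2 σ (single a x) = x • σ.translateL 2 a :=
  σ.conv_single 2 a x

lemma convL2_one : convL2 σ 1 = 1 := by
  rw [one_def, convL2_single]
  ext g c
  change 1 * ((σ 0 (c - 0) : ℂ) * g (c - 0)) = g c
  rw [sub_zero, σ.map_zero_left]
  simp

/-- The left `σ`-regular representation `λ_σ` of `ℓ¹(G, σ)` on `ℓ²(G)`, by twisted convolution. -/
def leftRegular (σ : Multiplier G) :
    TwistedL1 σ →⋆ₐ[ℂ] (lp (fun _ : G => ℂ) 2 →L[ℂ] lp (fun _ : G => ℂ) 2) where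
  toFun f := convL2 σ f
  map_one' := convL2_one
  map_mul' f g := σ.conv_conv 2 f g
  map_zero' := map_zero (convL2 σ)
  map_add' f g := map_add (convL2 σ) f g
  commutes' z := by
    rw [Algebra.algebraMap_eq_smul_one, map_smul, convL2_one, Algebra.algebraMap_eq_smul_one]
  map_star' f := by
    refine induction (P := fun f => convL2 σ (star f) = star (convL2 σ f))
      (isClosed_eq ?_ ?_) ?_ ?_ ?_ f
    · exact (convL2 σ).continuous.comp continuous_star'
    · exact continuous_star.comp (convL2 σ).continuous
    · simp
    · intro f f' h h'
      rw [star_add', map_add, map_add, h, h', star_add]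
    · intro a x
      rw [star_single, convL2_single, convL2_single, star_smul, map_mul, mul_smul]
      congr 1
      rw [ContinuousLinearMap.star_eq_adjoint, ContinuousLinearMap.eq_adjoint_iff]
      exact inner_translateL a

/-- The formula for the left regular representation. -/
lemma leftRegular_apply (f : TwistedL1 σ) (g : lp (fun _ : G => ℂ) 2) (c : G) :
    leftRegular σ f g c = ∑' a, (σ a (c - a) : ℂ) * f a * g (c - a) :=
  σ.conv_apply 2 f g c

/-- `C_C(G, σ)`: the functions of finite support, a unital `*`-subalgebra of `ℓ¹(G, σ)`. -/
def finsuppSubalgebra (σ : Multiplier G) : StarSubalgebra ℂ (TwistedL1 σ) where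
  carrier := {f | {c | f c ≠ 0}.Finite}
  mul_mem' {f g} hf hg := by
    refine (Set.Finite.add hf hg).subset fun c hc => ?_
    by_contra h
    refine hc ?_
    rw [mul_apply]
    refine (tsum_congr fun a => ?_).trans tsum_zero
    by_contra h'
    refine h ⟨a, ?_, c - a, ?_, by simp⟩
    · intro h0
      exact h' (by simp [h0])
    · intro h0
      exact h' (by simp [h0])
  add_mem' {f g} hf hg := by
    refine (Set.Finite.union hf hg).subset fun c hc => ?_
    by_contra h
    simp only [Set.mem_union, Set.mem_ofPred_eq, not_or, not_not] at h
    exact hc (by simp [h.1, h.2])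
  algebraMap_mem' z := by
    refine (Set.finite_singleton (0 : G)).subset fun c hc => ?_
    by_contra h
    refine hc ?_
    rw [Algebra.algebraMap_eq_smul_one, smul_apply, one_def, single_apply_ne h, mul_zero]
  star_mem' {f} hf := by
    refine (Set.Finite.image (fun c => -c) hf).subset fun c hc => ?_
    refine ⟨-c, ?_, neg_neg c⟩
    intro h0
    exact hc (by rw [star_apply, h0, zero_mul, map_zero])

end TwistedL1

/-! ### The enveloping `C*`-algebra of a unital Banach `*`-algebra -/

section Enveloping

universe u

variable (B : Type u) [NormedRing B] [NormedAlgebra ℂ B] [StarRing B] [StarModule ℂ B]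
  [NormedStarGroup B] [NormOneClass B] [CompleteSpace B]

variable {B} in
/-- A unital `*`-homomorphism from a Banach `*`-algebra to a `C*`-algebra is contractive. -/
lemma norm_starAlgHom_le {A : Type*} [CStarAlgebra A] (π : B →⋆ₐ[ℂ] A) (b : B) : ‖π b‖ ≤ ‖b‖ := by
  have h0 : spectralRadius ℂ (π (star b * b)) ≤ spectralRadius ℂ (star b * b) :=
    iSup_le_iSup_of_subset (AlgHom.spectrum_apply_subset π.toAlgHom (star b * b))
  have h1 : spectralRadius ℂ (π (star b * b)) = ‖π (star b * b)‖₊ :=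
    IsSelfAdjoint.spectralRadius_eq_nnnorm ((IsSelfAdjoint.star_mul_self b).map π)
  have h2 : ‖π (star b * b)‖ ≤ ‖star b * b‖ := by
    have := h0.trans (spectrum.spectralRadius_le_nnnorm (star b * b))
    rw [h1] at this
    exact_mod_cast this
  rw [map_mul, map_star, CStarRing.norm_star_mul_self] at h2
  have h3 : ‖star b * b‖ ≤ ‖b‖ * ‖b‖ := (norm_mul_le _ _).trans (by rw [norm_star])
  exact nonneg_le_nonneg_of_sq_le_sq (norm_nonneg b) (h2.trans h3)

/-- The set of the numbers `‖π b‖`, where `π` ranges over the unital `*`-representations of `B` on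
Hilbert spaces. -/
def repNorms (b : B) : Set ℝ :=
  {c | ∃ (H : Type u) (_ : NormedAddCommGroup H) (_ : InnerProductSpace ℂ H) (_ : CompleteSpace H)
    (π : B →⋆ₐ[ℂ] (H →L[ℂ] H)), c = ‖π b‖}

variable {B}

lemma repNorms_bddAbove (b : B) : BddAbove (repNorms B b) := by
  refine ⟨‖b‖, ?_⟩
  rintro _ ⟨H, _, _, _, π, rfl⟩
  exact norm_starAlgHom_le π b

lemma repNorms_nonempty (b : B) : (repNorms B b).Nonempty := by
  refine ⟨_, PUnit, inferInstance, inferInstance, inferInstance, ?_, rfl⟩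
  exact
    { toFun := fun _ => 0
      map_one' := Subsingleton.elim _ _
      map_mul' := fun _ _ => Subsingleton.elim _ _
      map_zero' := rfl
      map_add' := fun _ _ => Subsingleton.elim _ _
      commutes' := fun _ => Subsingleton.elim _ _
      map_star' := fun _ => Subsingleton.elim _ _ }

/-- The universal `C*`-seminorm `b ↦ sup_π ‖π b‖`. -/
def envNorm (b : B) : ℝ := sSup (repNorms B b)

lemma norm_le_envNorm {H : Type u} [NormedAddCommGroup H] [InnerProductSpace ℂ H] [CompleteSpace H]
    (π : B →⋆ₐ[ℂ] (H →L[ℂ] H)) (b : B) : ‖π b‖ ≤ envNorm b :=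
  le_csSup (repNorms_bddAbove b) ⟨H, _, _, _, π, rfl⟩

lemma envNorm_le {b : B} {C : ℝ}
    (h : ∀ (H : Type u) [NormedAddCommGroup H] [InnerProductSpace ℂ H] [CompleteSpace H]
      (π : B →⋆ₐ[ℂ] (H →L[ℂ] H)), ‖π b‖ ≤ C) : envNorm b ≤ C := by
  refine csSup_le (repNorms_nonempty b) ?_
  rintro _ ⟨H, _, _, _, π, rfl⟩
  exact h H π

lemma envNorm_nonneg (b : B) : 0 ≤ envNorm b := by
  obtain ⟨_, H, _, _, _, π, rfl⟩ := repNorms_nonempty b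
  exact (norm_nonneg _).trans (norm_le_envNorm π b)

lemma envNorm_le_norm (b : B) : envNorm b ≤ ‖b‖ :=
  envNorm_le fun _ _ _ _ π => norm_starAlgHom_le π b

variable (B) in
/-- The universal `C*`-seminorm, as a ring seminorm. -/
def envSeminorm : RingSeminorm B where
  toFun := envNorm
  map_zero' := le_antisymm (envNorm_le fun _ _ _ _ π => by simp) (envNorm_nonneg 0)
  add_le' a b := envNorm_le fun _ _ _ _ π => by
    rw [map_add]
    exact (norm_add_le _ _).trans (add_le_add (norm_le_envNorm π a) (norm_le_envNorm π b))
  neg' a := by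
    have h : ∀ a : B, envNorm (-a) ≤ envNorm a := fun a => envNorm_le fun _ _ _ _ π => by
      rw [map_neg, norm_neg]
      exact norm_le_envNorm π a
    exact le_antisymm (h a) (by simpa using h (-a))
  mul_le' a b := envNorm_le fun _ _ _ _ π => by
    rw [map_mul]
    exact (norm_mul_le _ _).trans (mul_le_mul (norm_le_envNorm π a) (norm_le_envNorm π b)
      (norm_nonneg _) (envNorm_nonneg a))

lemma envNorm_star_mul_self (b : B) : envNorm (star b * b) = envNorm b * envNorm b := by
  refine le_antisymm ?_ ?_
  · refine envNorm_le fun _ _ _ _ π => ?_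
    rw [map_mul, map_star, CStarRing.norm_star_mul_self]
    exact mul_self_le_mul_self (norm_nonneg _) (norm_le_envNorm π b)
  · have h : envNorm b ≤ √(envNorm (star b * b)) := envNorm_le fun _ _ _ _ π => by
      refine Real.le_sqrt_of_sq_le ?_
      rw [sq, ← CStarRing.norm_star_mul_self, ← map_star, ← map_mul]
      exact norm_le_envNorm π _
    exact (mul_self_le_mul_self (envNorm_nonneg b) h).trans
      (Real.mul_self_sqrt (envNorm_nonneg _)).le

lemma envNorm_star (b : B) : envNorm (star b) = envNorm b := by
  have h : ∀ b : B, envNorm (star b) ≤ envNorm b := fun b => envNorm_le fun _ _ _ _ π => by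
    rw [map_star, norm_star]
    exact norm_le_envNorm π b
  exact le_antisymm (h b) (by simpa using h (star b))

variable (B) in
/-- The algebra `B`, equipped with its universal `C*`-seminorm instead of its norm. -/
def PreEnveloping : Type u := B

namespace PreEnveloping

instance : Ring (PreEnveloping B) := inferInstanceAs (Ring B)
instance : Algebra ℂ (PreEnveloping B) := inferInstanceAs (Algebra ℂ B)
instance : StarRing (PreEnveloping B) := inferInstanceAs (StarRing B)
instance : StarModule ℂ (PreEnveloping B) := inferInstanceAs (StarModule ℂ B)
instance : SeminormedRing (PreEnveloping B) :=
  { (envSeminorm B).toSeminormedRing with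
    toRing := inferInstanceAs (Ring (PreEnveloping B)) }

variable (B) in
/-- The identity map. -/
def of : B ≃⋆ₐ[ℂ] PreEnveloping B := StarAlgEquiv.refl ℂ B

lemma norm_of (b : B) : ‖of B b‖ = envNorm b := rfl

instance : NormedAlgebra ℂ (PreEnveloping B) where
  norm_smul_le z b := envNorm_le fun _ _ _ _ π => by
    refine (congrArg norm (map_smul π z (show B from b))).le.trans ?_
    rw [norm_smul]
    exact mul_le_mul_of_nonneg_left (norm_le_envNorm π b) (norm_nonneg z)

instance : NormedStarGroup (PreEnveloping B) where
  norm_star_le b := (envNorm_star (B := B) b).le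

lemma norm_star_mul_self (b : PreEnveloping B) : ‖star b * b‖ = ‖b‖ * ‖b‖ :=
  envNorm_star_mul_self (show B from b)

end PreEnveloping

variable (B) in
/-- The enveloping `C*`-algebra of a unital Banach `*`-algebra `B`: the (Hausdorff) completion of
`B` with respect to its universal `C*`-seminorm. -/
def EnvelopingCStar : Type u := UniformSpace.Completion (PreEnveloping B)

namespace EnvelopingCStar

open UniformSpace

instance : NormedRing (EnvelopingCStar B) :=
  inferInstanceAs (NormedRing (Completion (PreEnveloping B)))

instance : CompleteSpace (EnvelopingCStar B) :=
  inferInstanceAs (CompleteSpace (Completion (PreEnveloping B)))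

instance : Algebra ℂ (EnvelopingCStar B) :=
  inferInstanceAs (Algebra ℂ (Completion (PreEnveloping B)))

instance : NormedAlgebra ℂ (EnvelopingCStar B) where
  norm_smul_le z x := by
    have : ‖z • (show Completion (PreEnveloping B) from x)‖ ≤ ‖z‖ * ‖x‖ := norm_smul_le z _
    exact this

variable (B) in
/-- The canonical map of `B` to its enveloping `C*`-algebra. -/
def coe : B → EnvelopingCStar B := fun b => ((PreEnveloping.of B b : PreEnveloping B) :
  Completion (PreEnveloping B))

lemma coe_add (a b : B) : coe B (a + b) = coe B a + coe B b :=
  Completion.coe_add (PreEnveloping.of B a) (PreEnveloping.of B b)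

lemma coe_mul (a b : B) : coe B (a * b) = coe B a * coe B b :=
  Completion.coe_mul (PreEnveloping.of B a) (PreEnveloping.of B b)

lemma norm_coe (b : B) : ‖coe B b‖ = envNorm b :=
  Completion.norm_coe (PreEnveloping.of B b)

lemma denseRange_coe : DenseRange (coe B) :=
  Completion.denseRange_coe (α := PreEnveloping B)

lemma induction {P : EnvelopingCStar B → Prop} (x : EnvelopingCStar B) (hc : IsClosed {x | P x})
    (h : ∀ b : B, P (coe B b)) : P x :=
  denseRange_coe.induction_on x hc h

instance : Star (EnvelopingCStar B) :=
  ⟨Completion.map (star : PreEnveloping B → PreEnveloping B)⟩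

lemma uniformContinuous_star_pre :
    UniformContinuous (star : PreEnveloping B → PreEnveloping B) :=
  star_isometry.uniformContinuous

lemma continuous_star' : Continuous (star : EnvelopingCStar B → EnvelopingCStar B) :=
  Completion.continuous_map

lemma coe_star (b : B) : coe B (star b) = star (coe B b) :=
  (Completion.map_coe uniformContinuous_star_pre (PreEnveloping.of B b)).symm

lemma induction₂ {P : EnvelopingCStar B → EnvelopingCStar B → Prop} (x y : EnvelopingCStar B)
    (hc : IsClosed {z : EnvelopingCStar B × EnvelopingCStar B | P z.1 z.2})
    (h : ∀ a b : B, P (coe B a) (coe B b)) : P x y :=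
  denseRange_coe.induction_on₂ hc h x y

instance : StarRing (EnvelopingCStar B) where
  star_involutive x := by
    refine induction (P := fun x => star (star x) = x) x (isClosed_eq ?_ ?_) ?_
    · exact continuous_star'.comp continuous_star'
    · exact continuous_id
    · intro b
      rw [← coe_star, ← coe_star, star_star]
  star_add x y := by
    refine induction₂ (P := fun x y => star (x + y) = star x + star y) x y (isClosed_eq ?_ ?_) ?_
    · exact continuous_star'.comp continuous_add
    · exact (continuous_star'.comp continuous_fst).add (continuous_star'.comp continuous_snd)
    · intro a b
      rw [← coe_add, ← coe_star, ← coe_star, ← coe_star, star_add, coe_add]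
  star_mul x y := by
    refine induction₂ (P := fun x y => star (x * y) = star y * star x) x y (isClosed_eq ?_ ?_) ?_
    · exact continuous_star'.comp continuous_mul
    · exact (continuous_star'.comp continuous_snd).mul (continuous_star'.comp continuous_fst)
    · intro a b
      rw [← coe_mul, ← coe_star, ← coe_star, ← coe_star, star_mul, coe_mul]

instance : CStarRing (EnvelopingCStar B) where
  norm_mul_self_le x := by
    refine induction (P := fun x => ‖x‖ * ‖x‖ ≤ ‖star x * x‖) x (isClosed_le ?_ ?_) ?_
    · exact continuous_norm.mul continuous_norm
    · exact (continuous_star'.mul continuous_id).norm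
    · intro b
      rw [← coe_star, ← coe_mul, norm_coe, norm_coe, envNorm_star_mul_self]

lemma coe_smul (z : ℂ) (b : B) : coe B (z • b) = z • coe B b :=
  Completion.coe_smul z (PreEnveloping.of B b)

instance : StarModule ℂ (EnvelopingCStar B) where
  star_smul z x := by
    refine induction (P := fun x => star (z • x) = star z • star x) x (isClosed_eq ?_ ?_) ?_
    · exact continuous_star'.comp ((continuous_id (X := EnvelopingCStar B)).const_smul z)
    · exact (continuous_star' (B := B)).const_smul (star z)
    · intro b
      rw [← coe_smul, ← coe_star, ← coe_star, star_smul, coe_smul]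

instance : CStarAlgebra (EnvelopingCStar B) where

variable (B) in
/-- The canonical `*`-homomorphism of `B` to its enveloping `C*`-algebra. -/
def ι : B →⋆ₐ[ℂ] EnvelopingCStar B where
  toFun := coe B
  map_one' := rfl
  map_mul' := coe_mul
  map_zero' := rfl
  map_add' := coe_add
  commutes' _ := rfl
  map_star' := coe_star

lemma norm_ι (b : B) : ‖ι B b‖ = envNorm b := norm_coe b

lemma denseRange_ι : DenseRange (ι B) := denseRange_coe

variable {H : Type u} [NormedAddCommGroup H] [InnerProductSpace ℂ H] [CompleteSpace H]

/-- The extension of a `*`-representation of `B` to the enveloping `C*`-algebra, by continuity. -/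
def extend (π : B →⋆ₐ[ℂ] (H →L[ℂ] H)) : EnvelopingCStar B → (H →L[ℂ] H) :=
  Completion.extension (fun b : PreEnveloping B => π ((PreEnveloping.of B).symm b))

lemma uniformContinuous_pre (π : B →⋆ₐ[ℂ] (H →L[ℂ] H)) :
    UniformContinuous (fun b : PreEnveloping B => π ((PreEnveloping.of B).symm b)) := by
  refine (LipschitzWith.of_dist_le_mul (K := 1) fun a b => ?_).uniformContinuous
  rw [dist_eq_norm, dist_eq_norm, NNReal.coe_one, one_mul, ← map_sub, ← map_sub]
  exact norm_le_envNorm π _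

lemma continuous_extend (π : B →⋆ₐ[ℂ] (H →L[ℂ] H)) : Continuous (extend π) :=
  Completion.continuous_extension

lemma extend_coe (π : B →⋆ₐ[ℂ] (H →L[ℂ] H)) (b : B) : extend π (coe B b) = π b :=
  Completion.extension_coe (uniformContinuous_pre π) _

/-- The extension of a `*`-representation of `B` to a `*`-representation of its enveloping
`C*`-algebra. -/
def lift (π : B →⋆ₐ[ℂ] (H →L[ℂ] H)) : EnvelopingCStar B →⋆ₐ[ℂ] (H →L[ℂ] H) where
  toFun := extend π
  map_one' := (extend_coe π 1).trans (map_one π)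
  map_mul' x y := by
    refine induction₂ (P := fun x y => extend π (x * y) = extend π x * extend π y) x y
      (isClosed_eq ?_ ?_) ?_
    · exact (continuous_extend π).comp continuous_mul
    · exact ((continuous_extend π).comp continuous_fst).mul
        ((continuous_extend π).comp continuous_snd)
    · intro a b
      rw [← coe_mul, extend_coe, extend_coe, extend_coe, map_mul]
  map_zero' := (extend_coe π 0).trans (map_zero π)
  map_add' x y := by
    refine induction₂ (P := fun x y => extend π (x + y) = extend π x + extend π y) x y
      (isClosed_eq ?_ ?_) ?_
    · exact (continuous_extend π).comp continuous_add
    · exact ((continuous_extend π).comp continuous_fst).add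
        ((continuous_extend π).comp continuous_snd)
    · intro a b
      rw [← coe_add, extend_coe, extend_coe, extend_coe, map_add]
  commutes' z := (extend_coe π _).trans (AlgHomClass.commutes π z)
  map_star' x := by
    refine induction (P := fun x => extend π (star x) = star (extend π x)) x (isClosed_eq ?_ ?_) ?_
    · exact (continuous_extend π).comp continuous_star'
    · exact continuous_star.comp (continuous_extend π)
    · intro b
      rw [← coe_star, extend_coe, extend_coe, map_star]

@[simp] lemma lift_ι (π : B →⋆ₐ[ℂ] (H →L[ℂ] H)) (b : B) : lift π (ι B b) = π b :=
  extend_coe π b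

lemma continuous_lift (π : B →⋆ₐ[ℂ] (H →L[ℂ] H)) : Continuous (lift π) :=
  continuous_extend π

end EnvelopingCStar

end Enveloping

/-! ### Spectral triples -/

section SpectralTriple

universe v

variable {H : Type v} [NormedAddCommGroup H] [InnerProductSpace ℂ H] [CompleteSpace H]

/-- The bounded operator `R` is the resolvent `(D - z)⁻¹` of the unbounded operator `D` at `z`: it
is a two-sided inverse of `D - z : dom D → H`. -/
def IsResolventAt (D : H →ₗ.[ℂ] H) (z : ℂ) (R : H →L[ℂ] H) : Prop :=
  (∀ y : H, ∃ h : R y ∈ D.domain, D ⟨R y, h⟩ - z • R y = y) ∧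
    ∀ x : D.domain, R (D x - z • (x : H)) = x

/-- `D` has compact resolvent: its resolvent set is non-empty and `(D - z)⁻¹` is a compact operator
for every `z` in the resolvent set. -/
def HasCompactResolvent (D : H →ₗ.[ℂ] H) : Prop :=
  (∃ z R, IsResolventAt D z R) ∧ ∀ z R, IsResolventAt D z R → IsCompactOperator R

/-- The natural domain of the commutator `[D, T]`. -/
def opCommutatorDomain (D : H →ₗ.[ℂ] H) (T : H →L[ℂ] H) : Submodule ℂ H :=
  D.domain ⊓ D.domain.comap (T : H →ₗ[ℂ] H)

/-- The commutator `[D, T] = D T - T D`, as an unbounded operator on its natural domain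
`{x ∈ dom D | T x ∈ dom D}`. -/
def opCommutator (D : H →ₗ.[ℂ] H) (T : H →L[ℂ] H) : H →ₗ.[ℂ] H where
  domain := opCommutatorDomain D T
  toFun :=
    { toFun := fun x => D ⟨T x, x.2.2⟩ - T (D ⟨x, x.2.1⟩)
      map_add' := fun x y => by
        have h1 : (⟨T (x + y : opCommutatorDomain D T), (x + y).2.2⟩ : D.domain) =
            ⟨T x, x.2.2⟩ + ⟨T y, y.2.2⟩ := Subtype.ext (map_add T _ _)
        have h2 : (⟨(x + y : opCommutatorDomain D T), (x + y).2.1⟩ : D.domain) =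
            ⟨x, x.2.1⟩ + ⟨y, y.2.1⟩ := rfl
        rw [h1, h2, D.map_add, D.map_add, map_add]
        abel
      map_smul' := fun c x => by
        have h1 : (⟨T (c • x : opCommutatorDomain D T), (c • x).2.2⟩ : D.domain) =
            c • ⟨T x, x.2.2⟩ := Subtype.ext (map_smul T _ _)
        have h2 : (⟨(c • x : opCommutatorDomain D T), (c • x).2.1⟩ : D.domain) =
            c • ⟨x, x.2.1⟩ := rfl
        rw [h1, h2, D.map_smul, D.map_smul, map_smul, RingHom.id_apply, smul_sub] }

/-- The unbounded operator `S` is densely defined and extends to a bounded operator on `H`. -/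
def ExtendsToBounded (S : H →ₗ.[ℂ] H) : Prop :=
  Dense (S.domain : Set H) ∧ ∃ T : H →L[ℂ] H, ∀ x : S.domain, T x = S x

/-- `(A, H, D)`, with the representation `π` of the unital `C*`-algebra `A` on `H`, is an (odd)
spectral triple with smooth subalgebra `𝒜`. -/
structure IsSpectralTriple {A : Type*} [CStarAlgebra A] (π : A →⋆ₐ[ℂ] (H →L[ℂ] H))
    (D : H →ₗ.[ℂ] H) (𝒜 : StarSubalgebra ℂ A) : Prop where
  faithful : Function.Injective π
  isSelfAdjoint : IsSelfAdjoint D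
  compactResolvent : HasCompactResolvent D
  dense : Dense (𝒜 : Set A)
  commutator_bounded : ∀ a ∈ 𝒜, ExtendsToBounded (opCommutator D (π a))

/-- A bounded operator `T` is of trace class: `∑ ⟨e_i, |T| e_i⟩` converges for an orthonormal
basis `(e_i)`; as `|T|` is positive, the choice of the basis is immaterial. -/
def IsTraceClass (T : H →L[ℂ] H) : Prop :=
  ∃ (ι : Type v) (e : HilbertBasis ι ℂ H), Summable fun i => ⟪e i, CFC.abs T (e i)⟫_ℂ

/-- The bounded positive operator `B` is the inverse `(1 + D²)⁻¹`. -/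
def IsInvOneAddSq (D : H →ₗ.[ℂ] H) (B : H →L[ℂ] H) : Prop :=
  0 ≤ B ∧
  (∀ y : H, ∃ (h : B y ∈ D.domain) (h' : D ⟨B y, h⟩ ∈ D.domain), B y + D ⟨D ⟨B y, h⟩, h'⟩ = y) ∧
  ∀ (x : D.domain) (h : D x ∈ D.domain), B (x + D ⟨D x, h⟩) = x

/-- `D` is finitely summable: there is `s > 0` such that `(1 + D²)^(-t/2)`, the power with exponent
`t/2` of the bounded positive operator `(1 + D²)⁻¹`, is of trace class for all `t > s`. -/
def IsFinitelySummable (D : H →ₗ.[ℂ] H) : Prop :=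
  ∃ s : ℝ, 0 < s ∧ ∀ t : ℝ, s < t →
    ∃ B : H →L[ℂ] H, IsInvOneAddSq D B ∧ IsTraceClass (B ^ (t / 2))

end SpectralTriple

/-- The operator on `ℓ²(X)` of pointwise multiplication by a real function `L`, with its maximal
domain `{f | L f ∈ ℓ²(X)}`. -/
def mulOperator {X : Type} (L : X → ℝ) : lp (fun _ : X => ℂ) 2 →ₗ.[ℂ] lp (fun _ : X => ℂ) 2 where
  domain :=
    { carrier := {f | Memℓp (fun x => (L x : ℂ) * f x) 2}
      add_mem' := fun {f g} hf hg => by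
        have e : (fun x => (L x : ℂ) * (f + g) x) =
            (fun x => (L x : ℂ) * f x) + fun x => (L x : ℂ) * g x :=
          funext fun x => mul_add _ _ _
        change Memℓp (fun x => (L x : ℂ) * (f + g) x) 2
        rw [e]
        exact Memℓp.add hf hg
      zero_mem' := by
        have e : (fun x => (L x : ℂ) * (0 : lp (fun _ : X => ℂ) 2) x) = 0 :=
          funext fun x => mul_zero _
        change Memℓp (fun x => (L x : ℂ) * (0 : lp (fun _ : X => ℂ) 2) x) 2
        rw [e]
        exact zero_memℓp
      smul_mem' := fun c f hf => by
        have e : (fun x => (L x : ℂ) * (c • f) x) = c • fun x => (L x : ℂ) * f x :=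
          funext fun x => mul_left_comm _ _ _
        change Memℓp (fun x => (L x : ℂ) * (c • f) x) 2
        rw [e]
        exact Memℓp.const_smul hf c }
  toFun :=
    { toFun := fun f => ⟨fun x => (L x : ℂ) * f.1 x, f.2⟩
      map_add' := fun f g => by
        ext x
        exact mul_add _ _ _
      map_smul' := fun c f => by
        ext x
        exact mul_left_comm _ _ _ }

lemma mem_mulOperator_domain {X : Type} (L : X → ℝ) (f : lp (fun _ : X => ℂ) 2) :
    f ∈ (mulOperator L).domain ↔ Memℓp (fun x => (L x : ℂ) * f x) 2 := Iff.rfl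

lemma mulOperator_apply {X : Type} (L : X → ℝ) (f : (mulOperator L).domain) (x : X) :
    mulOperator L f x = (L x : ℂ) * f.1 x := rfl

/-! ### Noncommutative solenoids -/

/-- The group `ℤ[1/p]`, as a subgroup of `ℚ`. -/
def ZInv (p : ℕ) [Fact p.Prime] : AddSubgroup ℚ where
  carrier := {r | ∃ (q : ℤ) (k : ℕ), r = q / (p : ℚ) ^ k}
  zero_mem' := ⟨0, 0, by simp⟩
  add_mem' := by
    rintro _ _ ⟨q, k, rfl⟩ ⟨q', k', rfl⟩
    have hp : (p : ℚ) ≠ 0 := Nat.cast_ne_zero.2 (Fact.out : p.Prime).ne_zero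
    refine ⟨q * p ^ k' + q' * p ^ k, k + k', ?_⟩
    push_cast
    rw [div_add_div _ _ (pow_ne_zero _ hp) (pow_ne_zero _ hp), pow_add, mul_comm (p ^ k : ℚ)]
  neg_mem' := by
    rintro _ ⟨q, k, rfl⟩
    exact ⟨-q, k, by push_cast; ring⟩

/-- The group `Γ = ℤ[1/p] × ℤ[1/p]`. -/
abbrev SolenoidGroup (p : ℕ) [Fact p.Prime] : Type := ZInv p × ZInv p

/-- The set `Ω_p` of the sequences `(θ_n)` in `[0, 1)` with `p θ_n = θ_{n-1}` modulo `ℤ` for all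
`n ≥ 1`. -/
def OmegaP (p : ℕ) : Set (ℕ → ℝ) :=
  {θ | (∀ n, θ n ∈ Set.Ico (0 : ℝ) 1) ∧ ∀ n, ∃ m : ℤ, (p : ℝ) * θ (n + 1) = θ n + m}

namespace ZInv

variable {p : ℕ} [Fact p.Prime]

/-- The numerator `q` of the reduced fraction `r = q / p ^ k`. -/
def num (r : ZInv p) : ℤ := (r : ℚ).num

/-- The exponent `k` of the reduced fraction `r = q / p ^ k`. -/
def expo (r : ZInv p) : ℕ := padicValNat p (r : ℚ).den

lemma eq_num_div (r : ZInv p) : (r : ℚ) = (ZInv.num r) / (p : ℚ) ^ (ZInv.expo r) := by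
  obtain ⟨q, k, h⟩ := r.2
  have hd : (r : ℚ).den ∣ p ^ k := by
    have h' : (r : ℚ) = Rat.divInt q ((p : ℤ) ^ k) := by
      rw [h, Rat.divInt_eq_div]
      push_cast
      rfl
    rw [h']
    exact_mod_cast Rat.den_dvd q ((p : ℤ) ^ k)
  obtain ⟨j, -, hj⟩ := (Nat.dvd_prime_pow Fact.out).1 hd
  have : (ZInv.expo r) = j := by
    rw [ZInv.expo, hj, padicValNat.prime_pow]
  rw [this, ZInv.num]
  conv_lhs => rw [← Rat.num_div_den (r : ℚ), hj]
  push_cast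
  rfl

end ZInv

namespace OmegaP

variable {p : ℕ} [Fact p.Prime] (θ : OmegaP p)

/-- `exp (2 π i θ_n m)`. -/
def chi (n : ℕ) (m : ℤ) : Circle := Circle.exp (2 * Real.pi * θ.1 n * m)

lemma chi_add (n : ℕ) (m m' : ℤ) : chi θ n (m + m') = chi θ n m * chi θ n m' := by
  rw [chi, chi, chi, ← Circle.exp_add]
  congr 1
  push_cast
  ring

lemma chi_zero (n : ℕ) : chi θ n 0 = 1 := by simp [chi]

lemma chi_succ (n : ℕ) (m : ℤ) : chi θ (n + 1) (m * p) = chi θ n m := by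
  obtain ⟨l, hl⟩ := θ.2.2 n
  have : 2 * Real.pi * θ.1 (n + 1) * ((m * p : ℤ) : ℝ) =
      2 * Real.pi * θ.1 n * m + (l * m : ℤ) * (2 * Real.pi) := by
    push_cast
    linear_combination (2 * Real.pi * m) * hl
  rw [chi, chi, this, Circle.exp_add]
  have h : Circle.exp ((l * m : ℤ) * (2 * Real.pi)) = 1 := by
    rw [mul_comm]
    exact Circle.exp_two_pi_mul_int _
  rw [h, mul_one]

lemma chi_add_pow (n j : ℕ) (m : ℤ) : chi θ (n + j) (m * p ^ j) = chi θ n m := by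
  induction j with
  | zero => simp
  | succ j ih =>
    rw [← add_assoc, pow_succ, ← mul_assoc, chi_succ, ih]

lemma chi_congr {q q' : ℤ} {k k' : ℕ} (h : (q : ℚ) / (p : ℚ) ^ k = q' / (p : ℚ) ^ k') :
    chi θ k q = chi θ k' q' := by
  have hp : (p : ℚ) ≠ 0 := Nat.cast_ne_zero.2 (Fact.out : p.Prime).ne_zero
  rw [div_eq_div_iff (pow_ne_zero _ hp) (pow_ne_zero _ hp)] at h
  have h' : q * (p : ℤ) ^ k' = q' * (p : ℤ) ^ k := by exact_mod_cast h
  rw [← chi_add_pow θ k k', ← chi_add_pow θ k' k, h', add_comm]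

/-- The function `((q₁/p^k₁, q₂/p^k₂), (q₃/p^k₃, q₄/p^k₄)) ↦ exp (2 π i θ_{k₁ + k₄} q₁ q₄)`
on `Γ × Γ`, written with the reduced fractions. -/
def sigma (a b : SolenoidGroup p) : Circle :=
  Circle.exp (2 * Real.pi * θ.1 ((ZInv.expo a.1) + (ZInv.expo b.2)) * ((ZInv.num a.1) * (ZInv.num b.2) : ℤ))

/-- `sigma` does not depend on the choice of the fractions. -/
lemma sigma_eq (a b : SolenoidGroup p) {q₁ q₄ : ℤ} {k₁ k₄ : ℕ}
    (h₁ : (a.1 : ℚ) = q₁ / (p : ℚ) ^ k₁) (h₄ : (b.2 : ℚ) = q₄ / (p : ℚ) ^ k₄) :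
    sigma θ a b = Circle.exp (2 * Real.pi * θ.1 (k₁ + k₄) * (q₁ * q₄ : ℤ)) := by
  refine chi_congr θ ?_
  rw [(ZInv.eq_num_div a.1)] at h₁
  rw [(ZInv.eq_num_div b.2)] at h₄
  push_cast
  rw [pow_add, pow_add, mul_div_mul_comm, mul_div_mul_comm, h₁, h₄]

lemma common_denom (r s : ZInv p) : ∃ (q q' : ℤ) (k : ℕ),
    (r : ℚ) = q / (p : ℚ) ^ k ∧ (s : ℚ) = q' / (p : ℚ) ^ k := by
  have hp : (p : ℚ) ≠ 0 := Nat.cast_ne_zero.2 (Fact.out : p.Prime).ne_zero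
  refine ⟨(ZInv.num r) * p ^ (ZInv.expo s), (ZInv.num s) * p ^ (ZInv.expo r), (ZInv.expo r) + (ZInv.expo s), ?_, ?_⟩
  · rw [(ZInv.eq_num_div r)]
    push_cast
    rw [pow_add, mul_div_mul_right _ _ (pow_ne_zero _ hp), ← (ZInv.eq_num_div r)]
  · rw [(ZInv.eq_num_div s)]
    push_cast
    rw [add_comm, pow_add, mul_div_mul_right _ _ (pow_ne_zero _ hp), ← (ZInv.eq_num_div s)]

lemma sigma_add_left (a a' b : SolenoidGroup p) :
    sigma θ (a + a') b = sigma θ a b * sigma θ a' b := by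
  obtain ⟨q, q', k, h, h'⟩ := common_denom a.1 a'.1
  have hs : ((a + a').1 : ℚ) = ((q + q' : ℤ) : ℚ) / (p : ℚ) ^ k := by
    push_cast
    rw [add_div, ← h, ← h']
    rfl
  rw [sigma_eq θ a b h (ZInv.eq_num_div b.2), sigma_eq θ a' b h' (ZInv.eq_num_div b.2),
    sigma_eq θ (a + a') b hs (ZInv.eq_num_div b.2), add_mul]
  exact chi_add θ _ _ _

lemma sigma_add_right (a b b' : SolenoidGroup p) :
    sigma θ a (b + b') = sigma θ a b * sigma θ a b' := by
  obtain ⟨q, q', k, h, h'⟩ := common_denom b.2 b'.2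
  have hs : ((b + b').2 : ℚ) = ((q + q' : ℤ) : ℚ) / (p : ℚ) ^ k := by
    push_cast
    rw [add_div, ← h, ← h']
    rfl
  rw [sigma_eq θ a b (ZInv.eq_num_div a.1) h, sigma_eq θ a b' (ZInv.eq_num_div a.1) h',
    sigma_eq θ a (b + b') (ZInv.eq_num_div a.1) hs, mul_add]
  exact chi_add θ _ _ _

/-- The multiplier `σ_θ` on `Γ = ℤ[1/p] × ℤ[1/p]`. -/
def multiplier : Multiplier (SolenoidGroup p) where
  toFun := sigma θ
  cocycle a b c := by
    rw [sigma_add_left, sigma_add_right, mul_assoc]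
  map_zero_left a := by
    simpa using sigma_add_left θ 0 0 a
  map_zero_right a := by
    simpa using sigma_add_right θ a 0 0

end OmegaP

/-- The length function `𝕃(r, s) = |r| + ‖r‖_p + |s| + ‖s‖_p` on `Γ`. -/
def solenoidLength (p : ℕ) [Fact p.Prime] (γ : SolenoidGroup p) : ℝ :=
  ((|(γ.1 : ℚ)| + padicNorm p γ.1 : ℚ) : ℝ) + ((|(γ.2 : ℚ)| + padicNorm p γ.2 : ℚ) : ℝ)

/-- The full twisted group `C*`-algebra `C*(G, σ)`: the enveloping `C*`-algebra of `ℓ¹(G, σ)`. -/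
abbrev TwistedGroupCStar {G : Type} [AddCommGroup G] (σ : Multiplier G) : Type :=
  EnvelopingCStar (TwistedL1 σ)

/-- The left `σ`-regular representation `λ_σ` of `C*(G, σ)` on `ℓ²(G)`. -/
def leftRegularCStar {G : Type} [AddCommGroup G] (σ : Multiplier G) :
    TwistedGroupCStar σ →⋆ₐ[ℂ] (lp (fun _ : G => ℂ) 2 →L[ℂ] lp (fun _ : G => ℂ) 2) :=
  EnvelopingCStar.lift (TwistedL1.leftRegular σ)

/-- The image of `C_C(G, σ)` in `C*(G, σ)`. -/
def smoothSubalgebra {G : Type} [AddCommGroup G] (σ : Multiplier G) :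
    StarSubalgebra ℂ (TwistedGroupCStar σ) :=
  (TwistedL1.finsuppSubalgebra σ).map (EnvelopingCStar.ι (TwistedL1 σ))

/-- The noncommutative solenoid `C*(Γ, σ_θ)`. -/
abbrev NCSolenoid {p : ℕ} [Fact p.Prime] (θ : OmegaP p) : Type :=
  TwistedGroupCStar (OmegaP.multiplier θ)

/-- The Dirac operator: multiplication by the length function on `ℓ²(Γ)`. -/
def solenoidDirac (p : ℕ) [Fact p.Prime] :
    lp (fun _ : SolenoidGroup p => ℂ) 2 →ₗ.[ℂ] lp (fun _ : SolenoidGroup p => ℂ) 2 :=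
  mulOperator (solenoidLength p)

end

/-! ### Multiplication operators on `ℓ²(X)` -/

section MulOperator

variable {X : Type}

/-! The Dirac operator is diagonal in the basis of point masses, so its properties are properties of
the length function `L`. Multiplication by a real function on its maximal domain is always
self-adjoint (`isSelfAdjoint_mulOperator`), and its resolvent is compact because `L` is nonnegative
and has finite balls (`hasCompactResolvent_mulOperator`). The commutator with the twisted
translation by `a` is that translation followed by multiplication by `L c - L (c - a)`.
Subadditivity and symmetry of `L` bound this function by `L a`, so finitely supported functions have
bounded commutators (`extendsToBounded_opCommutator_leftRegular`).

Summability is a count of reduced fractions `r = q / p ^ k`. If `k > 0`, then `p ^ k` is the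
`p`-adic norm of `r`, and `|q| = |r| p ^ k`; hence `p ^ k` and `1 + |q|` are both at most one plus
the squared length. The sum over the group is therefore dominated by products of a series in `q` and
a geometric series in `k` (`ZInv.summable_length`). Its convergence also yields the finiteness of
balls.

Faithfulness is the place where amenability enters. For a representation `π` and a vector `ξ`, the
matrix of `λ(f)`, applied to the family `π(δ_d)* ξ`, returns the family `π(δ_c)* π(f) ξ`. Cutting
off to finite sets `C` and `F` with `C - supp f ⊆ F` gives `|C| ‖π(f) ξ‖² ≤ |F| ‖λ(f)‖² ‖ξ‖²`. In an
abelian group the ratio `|F| / |C|` can be brought close to `1`, by polynomial growth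
(`le_of_card_mul_le_card_mul`), so `‖π(f)‖ ≤ ‖λ(f)‖`. Thus `λ` attains the universal norm on a dense
subalgebra and is isometric (`norm_leftRegularCStar`). -/

lemma memlp_mul_of_bounded {b : X → ℂ} {C : ℝ} (hC : ∀ x, ‖b x‖ ≤ C)
    (f : lp (fun _ : X => ℂ) 2) : Memℓp (fun x => b x * f x) 2 := by
  have hf := lp.memℓp f
  rw [memℓp_gen_iff (by simp)] at hf ⊢
  refine Summable.of_nonneg_of_le (fun x => by positivity) (fun x => ?_)
    (hf.mul_left (C ^ (2 : ℝ≥0∞).toReal))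
  rw [norm_mul, Real.mul_rpow (norm_nonneg _) (norm_nonneg _)]
  gcongr
  exact hC x

/-- The bounded operator on `ℓ²(X)` of pointwise multiplication by a bounded function. -/
noncomputable def boundedMul (b : X → ℂ) (C : ℝ) (hC : ∀ x, ‖b x‖ ≤ C) :
    lp (fun _ : X => ℂ) 2 →L[ℂ] lp (fun _ : X => ℂ) 2 :=
  LinearMap.mkContinuous
    { toFun := fun f => ⟨fun x => b x * f x, memlp_mul_of_bounded hC f⟩
      map_add' := fun f g => by
        ext x
        exact mul_add _ _ _
      map_smul' := fun c f => by
        ext x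
        exact mul_left_comm _ _ _ } |C| (fun f => by
      refine lp.norm_le_of_forall_sum_le (by simp) (by positivity) fun s => ?_
      rw [Real.mul_rpow (abs_nonneg _) (norm_nonneg _)]
      refine le_trans ?_ (mul_le_mul_of_nonneg_left
        (lp.sum_rpow_le_norm_rpow (by simp) f s) (by positivity))
      rw [Finset.mul_sum]
      refine Finset.sum_le_sum fun x _ => ?_
      rw [← Real.mul_rpow (abs_nonneg _) (norm_nonneg _)]
      refine Real.rpow_le_rpow (norm_nonneg _) ?_ (by simp)
      refine (norm_mul_le (b x) (f x)).trans ?_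
      gcongr
      exact (hC x).trans (le_abs_self C))

@[simp] lemma boundedMul_apply (b : X → ℂ) (C : ℝ) (hC : ∀ x, ‖b x‖ ≤ C)
    (f : lp (fun _ : X => ℂ) 2) (x : X) : boundedMul b C hC f x = b x * f x := rfl

lemma memlp_of_finite_support {f : X → ℂ} (hf : {x | f x ≠ 0}.Finite) : Memℓp f 2 :=
  (memℓp_zero hf).of_exponent_ge (zero_le (a := 2))

lemma mem_mulOperator_domain_of_finite_support (L : X → ℝ) {f : lp (fun _ : X => ℂ) 2}
    (hf : {x | f x ≠ 0}.Finite) : f ∈ (mulOperator L).domain :=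
  memlp_of_finite_support (hf.subset fun x hx h => hx (by simp [h]))

lemma finite_support_single [DecidableEq X] (x : X) (z : ℂ) :
    {y | (lp.single 2 x z : lp (fun _ : X => ℂ) 2) y ≠ 0}.Finite := by
  refine (Set.finite_singleton x).subset fun y hy => ?_
  by_contra h
  exact hy (lp.single_apply_ne _ _ _ h)

/-- A submodule of `ℓ²(X)` that contains the functions supported at a point is dense. -/
lemma dense_of_single_mem [DecidableEq X] (S : Submodule ℂ (lp (fun _ : X => ℂ) 2))
    (h : ∀ x z, lp.single 2 x z ∈ S) : Dense (S : Set (lp (fun _ : X => ℂ) 2)) := fun f =>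
  mem_closure_of_tendsto (lp.hasSum_single (by simp) f)
    (Filter.Eventually.of_forall fun s => S.sum_mem fun x _ => h x _)

lemma dense_mulOperator_domain (L : X → ℝ) :
    Dense ((mulOperator L).domain : Set (lp (fun _ : X => ℂ) 2)) := by
  classical
  exact dense_of_single_mem _ fun x z =>
    mem_mulOperator_domain_of_finite_support L (finite_support_single x z)

lemma isFormalAdjoint_mulOperator (L : X → ℝ) :
    (mulOperator L).IsFormalAdjoint (mulOperator L) := by
  intro f g
  rw [lp.inner_eq_tsum, lp.inner_eq_tsum]
  refine tsum_congr fun x => ?_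
  simp only [mulOperator_apply, RCLike.inner_apply, map_mul, Complex.conj_ofReal]
  ring

/-- Symmetry gives one inclusion. Conversely, pairing with point masses shows that the adjoint can
only send `f` to `L f`; so `L f` is square summable, and `f` already lies in the maximal domain. -/
theorem isSelfAdjoint_mulOperator (L : X → ℝ) : IsSelfAdjoint (mulOperator L) := by
  classical
  have hd := dense_mulOperator_domain L
  have hle := (isFormalAdjoint_mulOperator L).le_adjoint hd
  rw [LinearPMap.isSelfAdjoint_def]
  refine (LinearPMap.eq_of_le_of_domain_eq hle (le_antisymm hle.1 fun f hf => ?_)).symm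
  set g := (mulOperator L).adjoint ⟨f, hf⟩ with hg
  have key : ∀ x, g x = (L x : ℂ) * f x := fun x => by
    have hx := mem_mulOperator_domain_of_finite_support L (finite_support_single x 1)
    have h := LinearPMap.adjoint_isFormalAdjoint hd ⟨f, hf⟩ ⟨_, hx⟩
    have e : mulOperator L ⟨_, hx⟩ = lp.single 2 x (L x : ℂ) := by
      ext y
      rw [mulOperator_apply]
      by_cases hy : y = x
      · subst hy
        simp
      · simp [hy]
    rw [e] at h
    change ⟪g, lp.single 2 x 1⟫_ℂ = ⟪f, lp.single 2 x (L x : ℂ)⟫_ℂ at h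
    rw [lp.inner_single_right, lp.inner_single_right] at h
    have h' := congrArg (starRingEnd ℂ) h
    simpa [RCLike.inner_apply] using h'
  rw [mem_mulOperator_domain]
  have := lp.memℓp g
  rwa [show (g : X → ℂ) = fun x => (L x : ℂ) * f x from funext key] at this

/-- This controls an arbitrary resolvent pointwise, without first identifying it as a multiplication
operator. -/
lemma isResolventAt_apply {L : X → ℝ} {z : ℂ}
    {R : lp (fun _ : X => ℂ) 2 →L[ℂ] lp (fun _ : X => ℂ) 2} (hR : IsResolventAt (mulOperator L) z R)
    (f : lp (fun _ : X => ℂ) 2) (x : X) : ((L x : ℂ) - z) * R f x = f x := by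
  obtain ⟨h, e⟩ := hR.1 f
  have := congrArg (fun g : lp (fun _ : X => ℂ) 2 => g x) e
  simp only [lp.coeFn_sub, Pi.sub_apply, mulOperator_apply, lp.coeFn_smul, Pi.smul_apply,
    smul_eq_mul] at this
  rw [sub_mul, this]

lemma isResolventAt_neg_one {L : X → ℝ} (hL : ∀ x, 0 ≤ L x)
    (hC : ∀ x, ‖((L x : ℂ) + 1)⁻¹‖ ≤ 1) :
    IsResolventAt (mulOperator L) (-1) (boundedMul _ 1 hC) := by
  have hne : ∀ x, (L x : ℂ) + 1 ≠ 0 := fun x => by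
    exact_mod_cast (add_pos_of_nonneg_of_pos (hL x) one_pos).ne'
  have hmul : ∀ (f : lp (fun _ : X => ℂ) 2) x, (L x : ℂ) * (boundedMul _ 1 hC f x) =
      f x - boundedMul _ 1 hC f x := fun f x => by
    rw [boundedMul_apply]
    field_simp [hne x]
    ring
  refine ⟨fun f => ⟨?_, ?_⟩, fun f => ?_⟩
  · rw [mem_mulOperator_domain]
    have := lp.memℓp (f - boundedMul _ 1 hC f)
    rwa [show ((f - boundedMul _ 1 hC f : lp (fun _ : X => ℂ) 2) : X → ℂ) = _ from
      funext fun x => (hmul f x).symm] at this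
  · ext x
    simp only [lp.coeFn_sub, Pi.sub_apply, mulOperator_apply, lp.coeFn_smul, Pi.smul_apply,
      smul_eq_mul, hmul]
    ring
  · ext x
    simp only [boundedMul_apply, lp.coeFn_sub, Pi.sub_apply, mulOperator_apply, lp.coeFn_smul,
      Pi.smul_apply, smul_eq_mul]
    field_simp [hne x]
    ring

/-- The range lies in the span of finitely many point masses, so the operator factors through a
locally compact space. -/
lemma isCompactOperator_of_support_finite
    (T : lp (fun _ : X => ℂ) 2 →L[ℂ] lp (fun _ : X => ℂ) 2) (s : Finset X)
    (hT : ∀ f, ∀ x ∉ s, T f x = 0) : IsCompactOperator T := by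
  classical
  let V := Submodule.span ℂ ((fun x => (lp.single 2 x 1 : lp (fun _ : X => ℂ) 2)) '' s)
  have : FiniteDimensional ℂ V := FiniteDimensional.span_of_finite ℂ (s.finite_toSet.image _)
  have hV : ∀ f, T f ∈ V := fun f => by
    have e : T f = ∑ x ∈ s, T f x • (lp.single 2 x 1 : lp (fun _ : X => ℂ) 2) := by
      ext y
      rw [lp.coeFn_sum, Finset.sum_apply]
      by_cases hy : y ∈ s
      · rw [Finset.sum_eq_single y]
        · simp
        · intro x _ hx
          simp [Ne.symm hx]
        · exact fun h => absurd hy h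
      · rw [hT f y hy]
        refine (Finset.sum_eq_zero fun x hx => ?_).symm
        have : y ≠ x := fun h => hy (h ▸ hx)
        simp [this]
    rw [e]
    exact V.sum_mem fun x hx => V.smul_mem _ (Submodule.subset_span ⟨x, hx, rfl⟩)
  have : LocallyCompactSpace V := have := FiniteDimensional.proper ℂ V; inferInstance
  have hc : IsCompactOperator (T.codRestrict V hV) :=
    isCompactOperator_of_locallyCompactSpace_dom (T.codRestrict V hV)
  exact hc.clm_comp V.subtypeL

/-- The point `-1` is in the resolvent set since `L + 1 ≥ 1`. For any resolvent `R` at `z`, cutting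
`R` off to the finite set `L ≤ N` gives a finite rank operator. Outside that set `|L x - z| ≥ N -
‖z‖`, so the cut-offs converge to `R` in norm. -/
theorem hasCompactResolvent_mulOperator {L : X → ℝ} (hL : ∀ x, 0 ≤ L x)
    (hfin : ∀ N : ℕ, {x | L x ≤ N}.Finite) : HasCompactResolvent (mulOperator L) := by
  classical
  refine ⟨⟨-1, _, isResolventAt_neg_one hL fun x => ?_⟩, fun z R hR => ?_⟩
  · rw [norm_inv]
    refine inv_le_one_of_one_le₀ ?_
    have h : ((L x : ℂ) + 1) = ((L x + 1 : ℝ) : ℂ) := by push_cast; rfl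
    rw [h, Complex.norm_real, Real.norm_eq_abs]
    exact (le_add_of_nonneg_left (hL x)).trans (le_abs_self _)
  · have hb : ∀ N : ℕ, ∀ x, ‖(if L x ≤ N then 1 else 0 : ℂ)‖ ≤ 1 := fun N x => by
      split_ifs <;> simp
    refine isCompactOperator_of_tendsto (l := Filter.atTop)
      (F := fun N : ℕ => (boundedMul _ 1 (hb N)).comp R) ?_ (Filter.Eventually.of_forall fun N => ?_)
    · rw [tendsto_iff_norm_sub_tendsto_zero]
      have hlim : Filter.Tendsto (fun N : ℕ => ((N : ℝ) - ‖z‖)⁻¹) Filter.atTop (nhds 0) :=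
        (Filter.tendsto_atTop_add_const_right _ _ tendsto_natCast_atTop_atTop).inv_tendsto_atTop
      refine squeeze_zero' (Filter.Eventually.of_forall fun N => norm_nonneg _) ?_ hlim
      filter_upwards [tendsto_natCast_atTop_atTop.eventually_gt_atTop ‖z‖] with N hN
      have hpos : 0 < (N : ℝ) - ‖z‖ := sub_pos.2 hN
      refine ContinuousLinearMap.opNorm_le_bound _ (inv_nonneg.2 hpos.le) fun f => ?_
      refine lp.norm_le_of_forall_sum_le (by simp) (by positivity) fun s => ?_
      rw [Real.mul_rpow (inv_nonneg.2 hpos.le) (norm_nonneg _)]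
      refine le_trans ?_ (mul_le_mul_of_nonneg_left
        (lp.sum_rpow_le_norm_rpow (by simp) f s) (by positivity))
      rw [Finset.mul_sum]
      refine Finset.sum_le_sum fun x _ => ?_
      rw [← Real.mul_rpow (inv_nonneg.2 hpos.le) (norm_nonneg _)]
      refine Real.rpow_le_rpow (norm_nonneg _) ?_ (by simp)
      change ‖(if L x ≤ N then 1 else 0 : ℂ) * R f x - R f x‖ ≤ _
      split_ifs with h
      · simp only [one_mul, sub_self, norm_zero]
        positivity
      · rw [zero_mul, zero_sub, norm_neg, inv_mul_eq_div, le_div_iff₀ hpos,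
          ← isResolventAt_apply hR f x, norm_mul, mul_comm]
        gcongr
        refine le_trans ?_ (norm_sub_norm_le _ _)
        rw [Complex.norm_real, Real.norm_eq_abs]
        have := le_abs_self (L x)
        push Not at h
        linarith
    · refine isCompactOperator_of_support_finite _ (hfin N).toFinset fun f x hx => ?_
      rw [Set.Finite.mem_toFinset, Set.mem_ofPred_eq] at hx
      change (if L x ≤ N then 1 else 0 : ℂ) * R f x = 0
      rw [if_neg hx, zero_mul]

lemma isInvOneAddSq_mulOperator {L : X → ℝ} (hC : ∀ x, ‖(((1 + L x ^ 2)⁻¹ : ℝ) : ℂ)‖ ≤ 1) :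
    IsInvOneAddSq (mulOperator L) (boundedMul _ 1 hC) := by
  have hpos : ∀ x, 0 < 1 + L x ^ 2 := fun x => by positivity
  have hne : ∀ x, (1 : ℂ) + (L x : ℂ) ^ 2 ≠ 0 := fun x => by exact_mod_cast (hpos x).ne'
  -- The right side is square summable, which puts `D B f` in the domain of `D`.
  have hmul2 : ∀ (f : lp (fun _ : X => ℂ) 2) x, (L x : ℂ) * ((L x : ℂ) * (boundedMul _ 1 hC f x)) =
      f x - boundedMul _ 1 hC f x := fun f x => by
    rw [boundedMul_apply]
    push_cast
    field_simp [hne x]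
    ring
  -- Boundedness of `L / (1 + L²)` puts the range of `B` in the domain of `D`; it follows from `(|L|
  -- - 1)² ≥ 0`.
  have hle : ∀ x, ‖(L x : ℂ) * (((1 + L x ^ 2)⁻¹ : ℝ) : ℂ)‖ ≤ 1 := fun x => by
    rw [← Complex.ofReal_mul, Complex.norm_real, Real.norm_eq_abs, abs_mul, abs_inv,
      abs_of_pos (hpos x), ← div_eq_mul_inv, div_le_one (hpos x), ← sq_abs (L x)]
    nlinarith [sq_nonneg (|L x| - 1), abs_nonneg (L x)]
  have hdom : ∀ f, boundedMul _ 1 hC f ∈ (mulOperator L).domain := fun f => by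
    rw [mem_mulOperator_domain]
    have := lp.memℓp (boundedMul _ 1 hle f)
    rwa [show (boundedMul _ 1 hle f : X → ℂ) = _ from funext fun x => mul_assoc _ _ _] at this
  refine ⟨?_, fun f => ⟨hdom f, ?_, ?_⟩, fun f h => ?_⟩
  · rw [ContinuousLinearMap.nonneg_iff_isPositive,
      ContinuousLinearMap.isPositive_iff_complex]
    intro f
    have e : ⟪boundedMul _ 1 hC f, f⟫_ℂ =
        ((∑' x, (1 + L x ^ 2)⁻¹ * ‖f x‖ ^ 2 : ℝ) : ℂ) := by
      rw [lp.inner_eq_tsum, Complex.ofReal_tsum]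
      refine tsum_congr fun x => ?_
      rw [boundedMul_apply, RCLike.inner_apply, map_mul, Complex.conj_ofReal, mul_left_comm,
        Complex.mul_conj, Complex.normSq_eq_norm_sq]
      push_cast
      rfl
    rw [e]
    refine ⟨by simp, ?_⟩
    simp only [RCLike.re_to_complex, Complex.ofReal_re]
    exact tsum_nonneg fun x => by positivity
  · rw [mem_mulOperator_domain]
    have := lp.memℓp (f - boundedMul _ 1 hC f)
    rwa [show ((f - boundedMul _ 1 hC f : lp (fun _ : X => ℂ) 2) : X → ℂ) = _ from
      funext fun x => (hmul2 f x).symm] at this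
  · ext x
    rw [lp.coeFn_add, Pi.add_apply, mulOperator_apply, mulOperator_apply, hmul2]
    ring
  · ext x
    rw [boundedMul_apply, lp.coeFn_add, Pi.add_apply, mulOperator_apply, mulOperator_apply]
    push_cast
    field_simp [hne x]

end MulOperator

/-! ### Continuous functional calculus on eigenvectors. -/

section EigenvectorCalculus

variable {H : Type*} [NormedAddCommGroup H] [InnerProductSpace ℂ H] [CompleteSpace H]

lemma mem_spectrum_of_apply_eq_smul {B : H →L[ℂ] H} {x : H} (hx : x ≠ 0) {r : ℝ}
    (h : B x = (r : ℂ) • x) : r ∈ spectrum ℝ B := by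
  rintro ⟨u, hu⟩
  have h1 : (u : H →L[ℂ] H) x = 0 := by
    rw [hu, Algebra.algebraMap_eq_smul_one]
    change r • x - B x = 0
    rw [h, Complex.coe_smul, sub_self]
  have h2 : ((↑u⁻¹ * ↑u : H →L[ℂ] H)) x = x := by
    rw [Units.inv_mul]
    rfl
  exact hx (by rw [← h2, mul_apply_eq_comp, h1, map_zero])

/-- The functional calculus acts on an eigenvector through the eigenvalue. -/
lemma cfc_apply_eigenvector {B : H →L[ℂ] H} (hB : IsSelfAdjoint B) {x : H} {r : ℝ}
    (h : B x = (r : ℂ) • x) {f : ℝ → ℝ} (hf : ContinuousOn f (spectrum ℝ B)) :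
    cfc f B x = ((f r : ℝ) : ℂ) • x := by
  -- For `x = 0` the number `r` need not belong to the spectrum, so this case is separate.
  rcases eq_or_ne x 0 with rfl | hx
  · simp
  have hr := mem_spectrum_of_apply_eq_smul hx h
  rw [cfc_apply f B]
  suffices H : ∀ g : C(spectrum ℝ B, ℝ), cfcHom hB g x = ((g ⟨r, hr⟩ : ℝ) : ℂ) • x from H _
  intro g
  -- Stone–Weierstrass: the functions for which the formula holds form a closed subalgebra
  -- containing the constants and the identity.
  induction g using ContinuousMap.induction_on_of_compact with
  | const c =>
    have : cfcHom hB (ContinuousMap.const _ c) = algebraMap ℝ (H →L[ℂ] H) c :=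
      AlgHomClass.commutes (cfcHom hB) c
    rw [this, Algebra.algebraMap_eq_smul_one]
    change c • x = _
    rw [ContinuousMap.const_apply, Complex.coe_smul]
  | id => rw [cfcHom_id hB, h]; rfl
  | star_id => rw [map_star, cfcHom_id hB, hB.star_eq, h]; rfl
  | add f g hf hg =>
    rw [map_add, add_apply, hf, hg, ← add_smul]
    simp
  | mul f g hf hg =>
    rw [map_mul, mul_apply_eq_comp, hg, map_smul, hf, smul_smul]
    simp [mul_comm]
  | frequently f h =>
    refine h.mem_of_closed (isClosed_eq ?_ ?_)
    · exact (ContinuousLinearMap.apply ℂ H x).continuous.comp (cfcHom_continuous hB)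
    · exact (Complex.continuous_ofReal.comp (continuous_eval_const _)).smul
        continuous_const

lemma rpow_apply_eigenvector {B : H →L[ℂ] H} (hB : 0 ≤ B) {x : H} {r : ℝ}
    (h : B x = (r : ℂ) • x) {s : ℝ} (hs : 0 ≤ s) :
    (B ^ s) x = ((r ^ s : ℝ) : ℂ) • x := by
  rw [CFC.rpow_eq_cfc_real hB]
  exact cfc_apply_eigenvector (IsSelfAdjoint.of_nonneg hB) h
    (Real.continuous_rpow_const hs).continuousOn

end EigenvectorCalculus

/-! ### Finite summability of multiplication operators. -/

theorem isFinitelySummable_mulOperator {X : Type} {L : X → ℝ} {s : ℝ} (hs : 0 < s)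
    (h : ∀ t, s < t → Summable fun x => ((1 + L x ^ 2)⁻¹) ^ (t / 2)) :
    IsFinitelySummable (mulOperator L) := by
  classical
  refine ⟨s, hs, fun t ht => ?_⟩
  have hC : ∀ x, ‖(((1 + L x ^ 2)⁻¹ : ℝ) : ℂ)‖ ≤ 1 := fun x => by
    rw [Complex.norm_real, Real.norm_eq_abs, abs_of_pos (by positivity)]
    exact inv_le_one_of_one_le₀ (le_add_of_nonneg_right (sq_nonneg _))
  have hB := isInvOneAddSq_mulOperator hC
  -- The basis of point masses diagonalises `(1 + D²)⁻¹`, so the trace is the sum of the powers of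
  -- its eigenvalues.
  refine ⟨_, hB, X, HilbertBasis.ofRepr (LinearIsometryEquiv.refl ℂ _), ?_⟩
  have hev : ∀ x, boundedMul _ 1 hC (lp.single 2 x 1) =
      (((1 + L x ^ 2)⁻¹ : ℝ) : ℂ) • (lp.single 2 x 1 : lp (fun _ : X => ℂ) 2) := fun x => by
    ext y
    rw [boundedMul_apply]
    by_cases hy : y = x
    · subst hy
      simp
    · simp [hy]
  rw [CFC.abs_of_nonneg _ CFC.rpow_nonneg]
  refine (Complex.ofRealCLM.summable (h t ht)).congr fun x => ?_
  have hb : (HilbertBasis.ofRepr (LinearIsometryEquiv.refl ℂ (lp (fun _ : X => ℂ) 2)) :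
      HilbertBasis X ℂ _) x = lp.single 2 x 1 := by
    rw [← HilbertBasis.repr_symm_single]
    rfl
  rw [hb, rpow_apply_eigenvector hB.1 (hev x) (by linarith), inner_smul_right,
    lp.inner_single_left]
  simp

/-! ### Amenability of abelian groups and the regular representation -/

section Amenability

variable {G : Type} [AddCommGroup G]

open scoped Classical in
/-- The set of the elements `-∑ s ∈ S, m s • s` with `m s ≤ n`. -/
noncomputable def negBox (S : Finset G) (n : ℕ) : Finset G :=
  (Fintype.piFinset fun _ : S => Finset.range (n + 1)).image fun m => -∑ s : S, m s • (s : G)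

lemma card_negBox_le (S : Finset G) (n : ℕ) : (negBox S n).card ≤ (n + 1) ^ S.card := by
  classical
  refine Finset.card_image_le.trans ?_
  simp

lemma zero_mem_negBox (S : Finset G) (n : ℕ) : (0 : G) ∈ negBox S n := by
  classical
  exact Finset.mem_image.2 ⟨0, by simp, by simp⟩

lemma sub_mem_negBox {S : Finset G} {n : ℕ} {c a : G} (hc : c ∈ negBox S n) (ha : a ∈ S) :
    c - a ∈ negBox S (n + 1) := by
  classical
  obtain ⟨m, hm, rfl⟩ := Finset.mem_image.1 hc
  refine Finset.mem_image.2 ⟨m + Pi.single ⟨a, ha⟩ 1, ?_, ?_⟩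
  · rw [Fintype.mem_piFinset] at hm ⊢
    intro s
    have := hm s
    rw [Finset.mem_range] at this ⊢
    have h1 : (Pi.single ⟨a, ha⟩ 1 : S → ℕ) s ≤ 1 := by
      rw [Pi.single_apply]
      split_ifs <;> simp
    rw [Pi.add_apply]
    omega
  · simp only [Pi.add_apply, add_smul, Finset.sum_add_distrib]
    rw [Finset.sum_eq_single (⟨a, ha⟩ : S) (f := fun s => (Pi.single ⟨a, ha⟩ 1 : S → ℕ) s • (s : G))]
    · simp only [Pi.single_eq_same, one_smul]
      abel
    · intro s _ hs
      simp [hs]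
    · simp

/-- A form of the Følner property of abelian groups, by polynomial growth. -/
lemma le_of_card_mul_le_card_mul (S : Finset G) {x y : ℝ} (hy : 0 ≤ y)
    (h : ∀ C F : Finset G, (∀ c ∈ C, ∀ a ∈ S, c - a ∈ F) → C.card * x ≤ F.card * y) : x ≤ y := by
  by_contra! hxy
  have hx : 0 < x := hy.trans_lt hxy
  -- The hypothesis is iterated along the growing boxes: if each step enlarges the box at least by
  -- the factor `x / y`, the growth is exponential.
  have hpow : ∀ n, x ^ n ≤ (negBox S n).card * y ^ n := by
    intro n
    induction n with
    | zero =>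
      simp only [pow_zero, mul_one, Nat.one_le_cast]
      exact Finset.card_pos.2 ⟨0, zero_mem_negBox S 0⟩
    | succ n ih =>
      have := h (negBox S n) (negBox S (n + 1)) fun c hc a ha => sub_mem_negBox hc ha
      calc x ^ (n + 1) = x ^ n * x := pow_succ _ _
        _ ≤ (negBox S n).card * y ^ n * x := by gcongr
        _ = y ^ n * ((negBox S n).card * x) := by ring
        _ ≤ y ^ n * ((negBox S (n + 1)).card * y) := by gcongr
        _ = _ := by ring
  rcases hy.eq_or_lt with rfl | hy'
  · have := hpow 1
    simp only [pow_one, mul_zero] at this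
    exact hx.not_ge this
  · have hr : 1 < x / y := (one_lt_div hy').2 hxy
    -- The box has at most `(n + 1) ^ |S|` elements. The exponent `n + 1` in the denominator matches
    -- that base, at the price of a factor `y / x`, so the right side is a shifted sequence tending
    -- to `0`.
    have hle : ∀ n : ℕ, (y / x : ℝ) ≤ ((n + 1 : ℕ) : ℝ) ^ S.card / (x / y) ^ (n + 1) := by
      intro n
      have h1 := (hpow n).trans (mul_le_mul_of_nonneg_right
        (Nat.cast_le.2 (card_negBox_le S n)) (pow_nonneg hy n))
      rw [div_pow, div_div_eq_mul_div, div_le_div_iff₀ hx (by positivity)]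
      push_cast at h1 ⊢
      calc y * x ^ (n + 1) = x ^ n * (x * y) := by ring
        _ ≤ (n + 1 : ℝ) ^ S.card * y ^ n * (x * y) := by gcongr
        _ = _ := by ring
    have hlim := (tendsto_pow_const_div_const_pow_of_one_lt S.card hr).comp
      (Filter.tendsto_add_atTop_nat 1)
    have := ge_of_tendsto' hlim hle
    exact (div_pos hy' hx).not_ge this

end Amenability

/-! ### Operators on `ℓ²(X)` acting on vector-valued functions. -/

section Amplification

variable {X H : Type*} [NormedAddCommGroup H] [InnerProductSpace ℂ H]

lemma sum_norm_sq_le_norm_sq (f : lp (fun _ : X => ℂ) 2) (s : Finset X) :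
    ∑ x ∈ s, ‖f x‖ ^ 2 ≤ ‖f‖ ^ 2 := by
  simpa using lp.sum_rpow_le_norm_rpow (p := 2) (by simp) f s

lemma norm_sq_sum_single [DecidableEq X] (f : X → ℂ) (s : Finset X) :
    ‖∑ x ∈ s, (lp.single 2 x (f x) : lp (fun _ : X => ℂ) 2)‖ ^ 2 = ∑ x ∈ s, ‖f x‖ ^ 2 := by
  simpa using lp.norm_sum_single (p := 2) (by simp) f s

/-- In an orthonormal basis of `H` the matrix acts on each coordinate function separately, so the
scalar bound can be summed over the coordinates. -/
lemma sum_norm_sq_matrix_le_of_finiteDimensional [DecidableEq X] [FiniteDimensional ℂ H]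
    (T : lp (fun _ : X => ℂ) 2 →L[ℂ] lp (fun _ : X => ℂ) 2) (C F : Finset X) (h : X → H) :
    ∑ c ∈ C, ‖∑ d ∈ F, T (lp.single 2 d 1) c • h d‖ ^ 2 ≤ ‖T‖ ^ 2 * ∑ d ∈ F, ‖h d‖ ^ 2 := by
  let b := stdOrthonormalBasis ℂ H
  have hcoord : ∀ i c, ⟪b i, ∑ d ∈ F, T (lp.single 2 d 1) c • h d⟫_ℂ =
      T (∑ d ∈ F, lp.single 2 d ⟪b i, h d⟫_ℂ) c := fun i c => by
    rw [inner_sum, map_sum, lp.coeFn_sum, Finset.sum_apply]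
    refine Finset.sum_congr rfl fun d _ => ?_
    have : (lp.single 2 d ⟪b i, h d⟫_ℂ : lp (fun _ : X => ℂ) 2) =
        ⟪b i, h d⟫_ℂ • lp.single 2 d 1 := by
      rw [← lp.single_smul, smul_eq_mul, mul_one]
    rw [inner_smul_right, this, map_smul, lp.coeFn_smul, Pi.smul_apply, smul_eq_mul, mul_comm]
  simp only [← b.sum_sq_norm_inner_right, hcoord]
  rw [Finset.sum_comm, Finset.sum_comm (s := F), Finset.mul_sum]
  refine Finset.sum_le_sum fun i _ => (sum_norm_sq_le_norm_sq _ C).trans ?_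
  rw [← norm_sq_sum_single, ← mul_pow]
  gcongr
  exact T.le_opNorm _

/-- The matrix of a bounded operator `T` on `ℓ²(X)` acts on `H`-valued functions with norm at most
`‖T‖`. -/
lemma sum_norm_sq_matrix_le [DecidableEq X]
    (T : lp (fun _ : X => ℂ) 2 →L[ℂ] lp (fun _ : X => ℂ) 2) (C F : Finset X) (h : X → H) :
    ∑ c ∈ C, ‖∑ d ∈ F, T (lp.single 2 d 1) c • h d‖ ^ 2 ≤ ‖T‖ ^ 2 * ∑ d ∈ F, ‖h d‖ ^ 2 := by
  -- Only the finitely many vectors `h d` with `d ∈ F` occur, so their span can replace `H`.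
  let V := Submodule.span ℂ (h '' F)
  have : FiniteDimensional ℂ V := FiniteDimensional.span_of_finite ℂ (F.finite_toSet.image _)
  let k : X → V := fun d =>
    if hd : d ∈ F then ⟨h d, Submodule.subset_span ⟨d, hd, rfl⟩⟩ else 0
  have hk : ∀ d ∈ F, (k d : H) = h d := fun d hd => by simp [k, hd]
  have key := sum_norm_sq_matrix_le_of_finiteDimensional T C F k
  have e1 : ∀ c, ‖∑ d ∈ F, T (lp.single 2 d 1) c • k d‖ =
      ‖∑ d ∈ F, T (lp.single 2 d 1) c • h d‖ := fun c => by
    rw [Submodule.coe_norm, Submodule.coe_sum]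
    refine congrArg norm (Finset.sum_congr rfl fun d hd => ?_)
    rw [Submodule.coe_smul, hk d hd]
  have e2 : ∑ d ∈ F, ‖k d‖ ^ 2 = ∑ d ∈ F, ‖h d‖ ^ 2 :=
    Finset.sum_congr rfl fun d hd => by rw [Submodule.coe_norm, hk d hd]
  simpa only [e1, e2] using key

end Amplification

/-! ### Comparison of an arbitrary representation with the regular one. -/

namespace TwistedL1

variable {G : Type} [AddCommGroup G] {σ : Multiplier G}

lemma norm_single (a : G) (x : ℂ) : ‖(single a x : TwistedL1 σ)‖ = ‖x‖ := by
  classical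
  exact lp.norm_single (E := fun _ : G => ℂ) (p := 1) (by simp) a x

lemma smul_single (z : ℂ) (a : G) (x : ℂ) :
    z • (single a x : TwistedL1 σ) = single a (z * x) := by
  classical
  exact (lp.single_smul (E := fun _ : G => ℂ) 1 a z x).symm

lemma circle_mul_conj (z : Circle) : (z : ℂ) * starRingEnd ℂ (z : ℂ) = 1 := by
  rw [Complex.mul_conj, Circle.normSq_coe, Complex.ofReal_one]

lemma star_single_mul_single (a : G) :
    star (single a 1 : TwistedL1 σ) * single a 1 = 1 := by
  rw [star_single, single_mul_single, neg_add_cancel, one_mul, mul_one, circle_mul_conj]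
  rfl

lemma single_mul_star_single (a : G) :
    (single a 1 : TwistedL1 σ) * star (single a 1) = 1 := by
  rw [star_single, single_mul_single, add_neg_cancel, one_mul, one_mul, σ.neg_comm,
    circle_mul_conj]
  rfl

/-- Up to the phase `σ a (c - a)`, `δ_c` is `δ_a δ_{c - a}`, and `δ_a` is unitary. This phase is the
one in the `(c, c - a)` entry of the matrix of `λ(f)`. -/
lemma star_single_mul_single_sub (a c : G) :
    star (single c 1 : TwistedL1 σ) * single a 1 =
      (σ a (c - a) : ℂ) • star (single (c - a) 1 : TwistedL1 σ) := by
  have h : (single c 1 : TwistedL1 σ) =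
      starRingEnd ℂ (σ a (c - a) : ℂ) • (single a 1 * single (c - a) 1) := by
    rw [single_mul_single, smul_single, add_sub_cancel, mul_one, mul_one, mul_comm,
      circle_mul_conj]
  rw [h, star_smul, star_mul, starRingEnd_apply, star_star, smul_mul_assoc, mul_assoc,
    star_single_mul_single, mul_one]

lemma eq_sum_single {f : TwistedL1 σ} {S : Finset G} (hS : ∀ a ∉ S, f a = 0) :
    f = ∑ a ∈ S, f a • single a 1 := by
  classical
  have hs : ∀ (s : Finset G) (c : G), (∑ a ∈ s, f a • (single a 1 : TwistedL1 σ)) c =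
      ∑ a ∈ s, f a * (single a 1 : TwistedL1 σ) c := fun s c => by
    induction s using Finset.cons_induction with
    | empty => simp
    | cons a s ha ih => rw [Finset.sum_cons, Finset.sum_cons, add_apply, ih, smul_apply]
  ext c
  rw [hs]
  by_cases hc : c ∈ S
  · rw [Finset.sum_eq_single c]
    · rw [single_apply_self, mul_one]
    · intro a _ ha
      rw [single_apply_ne (Ne.symm ha), mul_zero]
    · exact fun h => absurd hc h
  · rw [hS c hc]
    refine (Finset.sum_eq_zero fun a ha => ?_).symm
    rw [single_apply_ne (by rintro rfl; exact hc ha), mul_zero]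

lemma leftRegular_apply_of_support {f : TwistedL1 σ} {S : Finset G} (hS : ∀ a ∉ S, f a = 0)
    (g : lp (fun _ : G => ℂ) 2) (c : G) :
    leftRegular σ f g c = ∑ a ∈ S, (σ a (c - a) : ℂ) * f a * g (c - a) := by
  rw [leftRegular_apply, tsum_eq_sum]
  intro a ha
  rw [hS a ha, mul_zero, zero_mul]

lemma leftRegular_single [DecidableEq G] (f : TwistedL1 σ) (d : G) (z : ℂ) (c : G) :
    leftRegular σ f (lp.single 2 d z) c = (σ (c - d) d : ℂ) * f (c - d) * z := by
  rw [leftRegular_apply, tsum_eq_single (c - d)]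
  · rw [sub_sub_cancel, lp.single_apply_self]
  · intro a ha
    rw [lp.single_apply_ne, mul_zero]
    rintro h
    exact ha (by rw [← h, sub_sub_cancel])

/-- The left regular representation dominates all the `*`-representations on finitely supported
functions. -/
lemma norm_le_norm_leftRegular {H : Type} [NormedAddCommGroup H] [InnerProductSpace ℂ H]
    [CompleteSpace H] (π : TwistedL1 σ →⋆ₐ[ℂ] (H →L[ℂ] H)) {f : TwistedL1 σ}
    (hf : f ∈ finsuppSubalgebra σ) : ‖π f‖ ≤ ‖leftRegular σ f‖ := by
  classical
  let S : Finset G := Set.Finite.toFinset hf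
  have hS : ∀ a ∉ S, f a = 0 := fun a ha => by
    by_contra h
    exact ha ((Set.Finite.mem_toFinset _).2 h)
  have hle : ∀ (a : G) (ξ : H), ‖π (single a 1) ξ‖ ≤ ‖ξ‖ := fun a ξ => by
    refine (ContinuousLinearMap.le_opNorm _ _).trans (mul_le_of_le_one_left (norm_nonneg _) ?_)
    refine (norm_starAlgHom_le π _).trans ?_
    rw [norm_single, norm_one]
  have hle' : ∀ (a : G) (ξ : H), ‖π (star (single a 1)) ξ‖ ≤ ‖ξ‖ := fun a ξ => by
    refine (ContinuousLinearMap.le_opNorm _ _).trans (mul_le_of_le_one_left (norm_nonneg _) ?_)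
    refine (norm_starAlgHom_le π _).trans ?_
    rw [norm_star, norm_single, norm_one]
  have hge : ∀ (a : G) (ξ : H), ‖ξ‖ ≤ ‖π (star (single a 1)) ξ‖ := fun a ξ => by
    refine le_trans (le_of_eq ?_) (hle a _)
    rw [← mul_apply_eq_comp, ← map_mul, single_mul_star_single, map_one]
    rfl
  refine ContinuousLinearMap.opNorm_le_bound _ (norm_nonneg _) fun ξ => ?_
  refine le_of_sq_le_sq ?_ (by positivity)
  -- Følner comparison of `‖π f ξ‖²` with `(‖λ(f)‖ ‖ξ‖)²`, where `S` is the support of `f`.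
  refine le_of_card_mul_le_card_mul S (by positivity) fun C F hCF => ?_
  have key := sum_norm_sq_matrix_le (leftRegular σ f) C F fun d => π (star (single d 1)) ξ
  -- The truncation to `F` loses nothing: row `c` of the matrix is supported in `c - S ⊆ F`.
  have hsum : ∀ c ∈ C, ∑ d ∈ F, leftRegular σ f (lp.single 2 d 1) c • π (star (single d 1)) ξ =
      π (star (single c 1)) (π f ξ) := fun c hc => by
    have hsub : S.image (fun a => c - a) ⊆ F := fun d hd => by
      obtain ⟨a, ha, rfl⟩ := Finset.mem_image.1 hd
      exact hCF c hc a ha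
    rw [← Finset.sum_subset hsub, Finset.sum_image (fun a _ b _ h => sub_right_injective h)]
    · conv_rhs => rw [← mul_apply_eq_comp, ← map_mul, eq_sum_single hS]
      rw [Finset.mul_sum, map_sum, sum_apply]
      refine Finset.sum_congr rfl fun a _ => ?_
      rw [mul_smul_comm, star_single_mul_single_sub, smul_smul, map_smul, leftRegular_single,
        sub_sub_cancel, mul_one, mul_comm]
      rfl
    · intro d _ hd
      have : f (c - d) = 0 := hS _ fun h =>
        hd (Finset.mem_image.2 ⟨c - d, h, sub_sub_cancel c d⟩)
      rw [leftRegular_single, this]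
      simp
  calc (C.card : ℝ) * ‖π f ξ‖ ^ 2 = ∑ c ∈ C, ‖π f ξ‖ ^ 2 := by simp
    _ ≤ ∑ c ∈ C, ‖∑ d ∈ F, leftRegular σ f (lp.single 2 d 1) c • π (star (single d 1)) ξ‖ ^ 2 := by
      refine Finset.sum_le_sum fun c hc => ?_
      rw [hsum c hc]
      gcongr
      exact hge c _
    _ ≤ ‖leftRegular σ f‖ ^ 2 * ∑ d ∈ F, ‖π (star (single d 1)) ξ‖ ^ 2 := key
    _ ≤ ‖leftRegular σ f‖ ^ 2 * ∑ d ∈ F, ‖ξ‖ ^ 2 := by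
      gcongr with d _
      exact hle' d ξ
    _ = F.card * (‖leftRegular σ f‖ * ‖ξ‖) ^ 2 := by
      rw [Finset.sum_const, nsmul_eq_mul]
      ring

lemma single_mem_finsuppSubalgebra (a : G) (x : ℂ) : single a x ∈ finsuppSubalgebra σ := by
  refine (Set.finite_singleton a).subset fun c hc => ?_
  by_contra h
  exact hc (single_apply_ne h x)

end TwistedL1

/-! ### Density, faithfulness and commutators for the regular representation. -/

section RegularRepresentation

variable {G : Type} [AddCommGroup G] (σ : Multiplier G)

lemma continuous_envelopingι : Continuous (EnvelopingCStar.ι (TwistedL1 σ)) :=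
  AddMonoidHomClass.continuous_of_bound (EnvelopingCStar.ι (TwistedL1 σ)) 1 fun b => by
    rw [EnvelopingCStar.norm_ι, one_mul]
    exact envNorm_le_norm b

/-- Finitely supported functions are dense in `ℓ¹`, and the canonical map to the envelope is
contractive with dense range. -/
theorem dense_smoothSubalgebra :
    Dense (smoothSubalgebra σ : Set (TwistedGroupCStar σ)) := by
  intro x
  refine EnvelopingCStar.induction
    (P := fun x => x ∈ closure (smoothSubalgebra σ : Set (TwistedGroupCStar σ))) x
    isClosed_closure fun b => ?_
  change EnvelopingCStar.ι (TwistedL1 σ) b ∈ (smoothSubalgebra σ).topologicalClosure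
  refine TwistedL1.induction
    (P := fun b => EnvelopingCStar.ι (TwistedL1 σ) b ∈ (smoothSubalgebra σ).topologicalClosure)
    ?_ ?_ ?_ ?_ b
  · exact (StarSubalgebra.isClosed_topologicalClosure _).preimage (continuous_envelopingι σ)
  · simp
  · intro f g hf hg
    rw [map_add]
    exact add_mem hf hg
  · intro a z
    exact StarSubalgebra.le_topologicalClosure _
      ⟨_, TwistedL1.single_mem_finsuppSubalgebra a z, rfl⟩

/-- As `G` is amenable, the regular representation of `C*(G, σ)` is isometric. -/
theorem norm_leftRegularCStar (x : TwistedGroupCStar σ) : ‖leftRegularCStar σ x‖ = ‖x‖ := by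
  refine (dense_smoothSubalgebra σ).induction (P := fun x => ‖leftRegularCStar σ x‖ = ‖x‖)
    ?_ (isClosed_eq (EnvelopingCStar.continuous_lift _).norm continuous_norm) x
  rintro _ ⟨f, hf, rfl⟩
  change ‖EnvelopingCStar.lift (TwistedL1.leftRegular σ) (EnvelopingCStar.ι _ f)‖ =
    ‖EnvelopingCStar.ι _ f‖
  rw [EnvelopingCStar.lift_ι, EnvelopingCStar.norm_ι]
  -- The regular representation is one of those in the supremum, and it dominates all the others.
  exact le_antisymm (norm_le_envNorm _ f)
    (envNorm_le fun _ _ _ _ π => TwistedL1.norm_le_norm_leftRegular π hf)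

theorem leftRegularCStar_injective : Function.Injective (leftRegularCStar σ) :=
  (AddMonoidHomClass.isometry_of_norm (leftRegularCStar σ) (norm_leftRegularCStar σ)).injective

variable {σ} in
/-- The commutator of multiplication by a Lipschitz function with twisted convolution by a finitely
supported function is densely defined and bounded. -/
lemma extendsToBounded_opCommutator_leftRegular {L : G → ℝ} {K : G → ℝ}
    (hK : ∀ a c, |L c - L (c - a)| ≤ K a) {f : TwistedL1 σ}
    (hf : f ∈ TwistedL1.finsuppSubalgebra σ) :
    ExtendsToBounded (opCommutator (mulOperator L) (TwistedL1.leftRegular σ f)) := by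
  classical
  let S : Finset G := Set.Finite.toFinset hf
  have hS : ∀ a ∉ S, f a = 0 := fun a ha => by
    by_contra h
    exact ha ((Set.Finite.mem_toFinset _).2 h)
  have hK' : ∀ a c, ‖(L c : ℂ) - (L (c - a) : ℂ)‖ ≤ K a := fun a c => by
    rw [← Complex.ofReal_sub, Complex.norm_real]
    exact hK a c
  -- A point mass and its image under `λ(f)` both have finite support, so the domain is dense. The
  -- bounded extension is the `f`-weighted finite sum of the commutators with single translations.
  refine ⟨dense_of_single_mem _ fun d z =>
    ⟨mem_mulOperator_domain_of_finite_support L (finite_support_single d z),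
      mem_mulOperator_domain_of_finite_support L ?_⟩,
    ∑ a ∈ S, f a • (boundedMul _ (K a) (hK' a)).comp (σ.translateL 2 a), fun x => ?_⟩
  · refine (Set.Finite.image (fun a => a + d) hf).subset fun c hc => ⟨c - d, fun h => hc ?_, ?_⟩
    · change TwistedL1.leftRegular σ f (lp.single 2 d z) c = 0
      rw [TwistedL1.leftRegular_single, h]
      simp
    · simp
  · ext c
    have e : opCommutator (mulOperator L) (TwistedL1.leftRegular σ f) x c =
        (L c : ℂ) * TwistedL1.leftRegular σ f x c -
          TwistedL1.leftRegular σ f (mulOperator L ⟨x, x.2.1⟩) c := rfl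
    rw [e, TwistedL1.leftRegular_apply_of_support hS, TwistedL1.leftRegular_apply_of_support hS,
      Finset.mul_sum, ← Finset.sum_sub_distrib, sum_apply, lp.coeFn_sum,
      Finset.sum_apply]
    refine Finset.sum_congr rfl fun a _ => ?_
    change f a * (((L c : ℂ) - (L (c - a) : ℂ)) * ((σ a (c - a) : ℂ) * (x : lp (fun _ : G => ℂ) 2) (c - a))) = _
    rw [mulOperator_apply]
    ring

end RegularRepresentation

/-! ### The length function of the solenoid group -/

section Solenoid

variable {p : ℕ} [Fact p.Prime]

/-- The length function `|r| + ‖r‖_p` on `ℤ[1/p]`. -/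
def ZInv.length (r : ZInv p) : ℝ := ((|(r : ℚ)| + padicNorm p r : ℚ) : ℝ)

lemma ZInv.length_nonneg (r : ZInv p) : 0 ≤ ZInv.length r :=
  Rat.cast_nonneg.2 (add_nonneg (abs_nonneg _) (padicNorm.nonneg _))

lemma ZInv.length_add_le (r s : ZInv p) : ZInv.length (r + s) ≤ ZInv.length r + ZInv.length s := by
  rw [ZInv.length, ZInv.length, ZInv.length, ← Rat.cast_add]
  refine Rat.cast_le.2 ?_
  have h1 := abs_add_le (r : ℚ) s
  have h2 := padicNorm.triangle_ineq (p := p) (r : ℚ) s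
  rw [AddSubgroup.coe_add]
  linarith

lemma ZInv.length_neg (r : ZInv p) : ZInv.length (-r) = ZInv.length r := by
  rw [ZInv.length, ZInv.length, AddSubgroup.coe_neg, abs_neg, padicNorm.neg]

lemma solenoidLength_eq (γ : SolenoidGroup p) :
    solenoidLength p γ = ZInv.length γ.1 + ZInv.length γ.2 := rfl

lemma solenoidLength_nonneg (γ : SolenoidGroup p) : 0 ≤ solenoidLength p γ :=
  add_nonneg (ZInv.length_nonneg _) (ZInv.length_nonneg _)

lemma solenoidLength_add_le (a b : SolenoidGroup p) :
    solenoidLength p (a + b) ≤ solenoidLength p a + solenoidLength p b := by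
  have h1 := ZInv.length_add_le a.1 b.1
  have h2 := ZInv.length_add_le a.2 b.2
  rw [solenoidLength_eq, solenoidLength_eq, solenoidLength_eq, Prod.fst_add, Prod.snd_add]
  linarith

lemma solenoidLength_neg (a : SolenoidGroup p) : solenoidLength p (-a) = solenoidLength p a := by
  rw [solenoidLength_eq, solenoidLength_eq, Prod.fst_neg, Prod.snd_neg, ZInv.length_neg,
    ZInv.length_neg]

/-- The reverse triangle inequality; it supplies the Lipschitz bound for the commutators. -/
lemma abs_solenoidLength_sub_le (a c : SolenoidGroup p) :
    |solenoidLength p c - solenoidLength p (c - a)| ≤ solenoidLength p a := by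
  have h1 := solenoidLength_add_le (c - a) a
  have h2 := solenoidLength_add_le c (-a)
  rw [sub_add_cancel] at h1
  rw [← sub_eq_add_neg, solenoidLength_neg] at h2
  rw [abs_le]
  constructor <;> linarith

namespace ZInv

/-- Once `p` divides the denominator, it cannot divide the numerator, so the `p`-adic norm is
exactly this power. For exponent `0` the norm may be smaller than `1`. -/
lemma pow_expo_le (r : ZInv p) (h : expo r ≠ 0) : (p : ℝ) ^ expo r ≤ padicNorm p (r : ℚ) := by
  have hden : p ∣ (r : ℚ).den := dvd_of_one_le_padicValNat (Nat.one_le_iff_ne_zero.2 h)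
  have hnum : padicValInt p (r : ℚ).num = 0 := by
    refine padicValNat.eq_zero_of_not_dvd fun hd => ?_
    have := Nat.dvd_gcd hd hden
    rw [(r : ℚ).reduced] at this
    exact (Fact.out : p.Prime).one_lt.ne' (Nat.dvd_one.1 this)
  have hr : (r : ℚ) ≠ 0 := fun h0 => by
    rw [h0] at hden
    exact (Fact.out : p.Prime).one_lt.ne' (Nat.dvd_one.1 hden)
  rw [padicNorm.eq_zpow_of_nonzero hr, padicValRat, hnum]
  simp only [Nat.cast_zero, zero_sub, neg_neg, zpow_natCast]
  push_cast
  rfl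

lemma pow_expo_le_one_add_sq (r : ZInv p) : (p : ℝ) ^ expo r ≤ 1 + ZInv.length r ^ 2 := by
  by_cases h : expo r = 0
  · rw [h, pow_zero]
    exact le_add_of_nonneg_right (sq_nonneg _)
  · have h1 : (p : ℝ) ^ expo r ≤ ZInv.length r := by
      refine (pow_expo_le r h).trans ?_
      rw [length, Rat.cast_add]
      exact le_add_of_nonneg_left (Rat.cast_nonneg.2 (abs_nonneg _))
    nlinarith [sq_nonneg (ZInv.length r - 1), (ZInv.length_nonneg r)]

/-- For `k > 0`, `|q| = |r| p ^ k` and both factors are at most the length. For `k = 0`, `|q| = |r|`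
is an integer and hence at most its square. -/
lemma one_add_abs_num_le (r : ZInv p) : 1 + |(num r : ℝ)| ≤ 1 + ZInv.length r ^ 2 := by
  have hp : (0 : ℝ) < p := Nat.cast_pos.2 (Fact.out : p.Prime).pos
  have hr : |((r : ℚ) : ℝ)| = |(num r : ℝ)| / (p : ℝ) ^ expo r := by
    rw [eq_num_div r]
    push_cast
    rw [abs_div, abs_of_pos (pow_pos hp (expo r))]
  have habs : |((r : ℚ) : ℝ)| ≤ ZInv.length r := by
    rw [length, Rat.cast_add, Rat.cast_abs]
    exact le_add_of_nonneg_right (Rat.cast_nonneg.2 (padicNorm.nonneg _))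
  refine add_le_add_right ?_ 1
  by_cases h : expo r = 0
  · rw [h, pow_zero, div_one] at hr
    have h1 : |(num r : ℝ)| ≤ |(num r : ℝ)| ^ 2 := by
      rcases eq_or_ne (num r) 0 with h0 | h0
      · simp [h0]
      · have : (1 : ℝ) ≤ |(num r : ℝ)| := by exact_mod_cast Int.one_le_abs h0
        nlinarith
    rw [hr] at habs
    exact h1.trans (by gcongr)
  · have h1 : (p : ℝ) ^ expo r ≤ ZInv.length r := by
      refine (pow_expo_le r h).trans ?_
      rw [length, Rat.cast_add]
      exact le_add_of_nonneg_left (Rat.cast_nonneg.2 (abs_nonneg _))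
    rw [eq_div_iff (pow_pos hp _).ne'] at hr
    rw [← hr, sq]
    gcongr
    exact ZInv.length_nonneg r

lemma num_expo_injective : Function.Injective fun r : ZInv p => (num r, expo r) := by
  intro r s h
  obtain ⟨h1, h2⟩ := Prod.mk.inj h
  refine Subtype.ext ?_
  rw [eq_num_div r, eq_num_div s, h1, h2]

lemma summable_one_add_abs_rpow {v : ℝ} (hv : 1 < v) :
    Summable fun q : ℤ => (1 + |(q : ℝ)|) ^ (-v) := by
  have h : Summable fun n : ℕ => (1 + (n : ℝ)) ^ (-v) := by
    have := (summable_nat_add_iff 1).2 (Real.summable_nat_rpow.2 (neg_lt_neg hv))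
    refine this.congr fun n => ?_
    push_cast
    rw [add_comm]
  refine Summable.of_nat_of_neg ?_ ?_
  · simpa using h
  · simpa using h

/-- Half of the exponent pays for the numerator and half for the denominator. The condition `u / 2 >
1` is what the series over numerators requires; the series over `k` is geometric. -/
lemma summable_length {u : ℝ} (hu : 2 < u) :
    Summable fun r : ZInv p => (1 + ZInv.length r ^ 2) ^ (-u) := by
  have hp : (1 : ℝ) < p := Nat.one_lt_cast.2 (Fact.out : p.Prime).one_lt
  have hgeom : Summable fun k : ℕ => ((p : ℝ) ^ k) ^ (-(u / 2)) := by
    have h1 : (p : ℝ) ^ (-(u / 2)) < 1 := Real.rpow_lt_one_of_one_lt_of_neg hp (by linarith)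
    refine (summable_geometric_of_lt_one (by positivity) h1).congr fun k => ?_
    rw [← Real.rpow_natCast, ← Real.rpow_natCast, ← Real.rpow_mul (by positivity),
      ← Real.rpow_mul (by positivity), mul_comm]
  -- The double series over all pairs `(q, k)` is restricted to the reduced ones, which determine
  -- `r`.
  have hprod := ((summable_one_add_abs_rpow (v := u / 2) (by linarith)).mul_of_nonneg hgeom
    (fun q => by positivity) (fun k => by positivity)).comp_injective
      (num_expo_injective (p := p))
  refine Summable.of_nonneg_of_le (fun r => by positivity) (fun r => ?_) hprod
  have hX : 0 < 1 + ZInv.length r ^ 2 := by positivity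
  have e : (1 + ZInv.length r ^ 2) ^ (-u) =
      (1 + ZInv.length r ^ 2) ^ (-(u / 2)) * (1 + ZInv.length r ^ 2) ^ (-(u / 2)) := by
    rw [← Real.rpow_add hX]
    congr 1
    ring
  rw [e]
  refine mul_le_mul ?_ ?_ (by positivity) (by positivity)
  · exact Real.rpow_le_rpow_of_nonpos (by positivity) (one_add_abs_num_le r) (by linarith)
  · exact Real.rpow_le_rpow_of_nonpos (by positivity) (pow_expo_le_one_add_sq r) (by linarith)

end ZInv

/-- The exponent `t / 2` is split evenly between the two coordinates, and each half `t / 4` must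
exceed `2`; hence the bound `8`. -/
lemma summable_solenoidLength {t : ℝ} (ht : 8 < t) :
    Summable fun γ : SolenoidGroup p => ((1 + solenoidLength p γ ^ 2)⁻¹) ^ (t / 2) := by
  have h1 := ZInv.summable_length (p := p) (u := t / 4) (by linarith)
  refine Summable.of_nonneg_of_le (fun γ => by positivity) (fun γ => ?_)
    (h1.mul_of_nonneg h1 (fun r => by positivity) (fun r => by positivity))
  have hX : 0 < 1 + solenoidLength p γ ^ 2 := by positivity
  have e : ((1 + solenoidLength p γ ^ 2)⁻¹) ^ (t / 2) =
      (1 + solenoidLength p γ ^ 2) ^ (-(t / 4)) * (1 + solenoidLength p γ ^ 2) ^ (-(t / 4)) := by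
    rw [← Real.rpow_add hX, Real.inv_rpow hX.le, ← Real.rpow_neg hX.le]
    congr 1
    ring
  have hfst := ZInv.length_nonneg γ.1
  have hsnd := ZInv.length_nonneg γ.2
  rw [e, solenoidLength_eq]
  refine mul_le_mul ?_ ?_ (by positivity) (by positivity)
  · refine Real.rpow_le_rpow_of_nonpos (by positivity) ?_ (by linarith)
    gcongr
    linarith
  · refine Real.rpow_le_rpow_of_nonpos (by positivity) ?_ (by linarith)
    gcongr
    linarith

/-- The terms of a convergent series tend to zero, while on the ball they stay above the value at
length `N`. The choice `t = 9` is just some exponent beyond `8`. -/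
lemma finite_solenoidLength_le (N : ℕ) : {γ : SolenoidGroup p | solenoidLength p γ ≤ N}.Finite := by
  have h := (summable_solenoidLength (p := p) (t := 9) (by norm_num)).tendsto_cofinite_zero
  have hpos : (0 : ℝ) < ((1 + (N : ℝ) ^ 2)⁻¹) ^ ((9 : ℝ) / 2) := by positivity
  refine Set.Finite.subset (h.eventually_lt_const hpos) fun γ hγ hlt => ?_
  have hL := solenoidLength_nonneg γ
  rw [Set.mem_ofPred_eq] at hγ hlt
  refine hlt.not_ge ?_
  gcongr

end Solenoid

theorem mainTheorem1 (p : ℕ) [Fact p.Prime] (θ : OmegaP p) :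
    IsSpectralTriple (A := NCSolenoid θ) (leftRegularCStar (OmegaP.multiplier θ)) (solenoidDirac p)
        (smoothSubalgebra (OmegaP.multiplier θ)) ∧
      IsFinitelySummable (solenoidDirac p) := by
  refine ⟨⟨leftRegularCStar_injective _, isSelfAdjoint_mulOperator _,
    hasCompactResolvent_mulOperator solenoidLength_nonneg finite_solenoidLength_le,
    dense_smoothSubalgebra _, ?_⟩,
    isFinitelySummable_mulOperator (s := 8) (by norm_num) fun t ht => summable_solenoidLength ht⟩
  -- Smooth elements are images of finitely supported functions, on which the extended
  -- representation is convolution by `f`.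
  rintro _ ⟨f, hf, rfl⟩
  have e : leftRegularCStar (OmegaP.multiplier θ) (EnvelopingCStar.ι _ f) =
      TwistedL1.leftRegular (OmegaP.multiplier θ) f := EnvelopingCStar.lift_ι _ f
  change ExtendsToBounded (opCommutator (solenoidDirac p)
    (leftRegularCStar (OmegaP.multiplier θ) (EnvelopingCStar.ι _ f)))
  rw [e]
  exact extendsToBounded_opCommutator_leftRegular abs_solenoidLength_sub_le hf
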